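/- Let $N\ge 1$, $n=2^N$ and $r\ge 2$ be integers, and let $X$ be a random $r\times n$ matrix with independent columns, each column having entries in $\{0,1\}$ that sum to one; let $s$ be the expectation of $X$, and write $\mathbb{P}_s,\mathbb{E}_s$ for the underlying probability and expectation. For an $r\times n$ matrix $t$, $t^{(j)}\in\mathbb{R}^n$ is its $j$th line, and $\langle t,t'\rangle=\sum_{i,j}t_i^{(j)}t_i'^{(j)}$, $\|t\|^2=\langle t,t\rangle$. Haar basis. Let $\Lambda(-1)=\{(-1,0)\}$ and $\Lambda(j)=\{(j,k):0\le k\le 2^j-1\}$ for $0\le j\le N-1$, and let $\Lambda=\bigcup_{j=-1}^{N-1}\Lambda(j)$. Let $\varphi$ equal $1$ on $(0,1/2]$, $-1$ on $(1/2,1]$ and $0$ elsewhere. For $\lambda\in\Lambda$ let $\phi_\lambda\in\mathbb{R}^n$ have components, $i=1,\dots,n$, $\phi_{\lambda i}=1/\sqrt n$ if $\lambda=(-1,0)$ and $\phi_{\lambda i}=\frac{2^{j/2}}{\sqrt n}\varphi(2^j i/n-k)$ if $\lambda=(j,k)$ with $j\ge 0$. Non-exhaustive Haar (NEH) strategy.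 For $0\le J\le N-1$ let $\mathcal{M}_J$ be the collection of all sets $m=\bigcup_{j=-1}^{J-1}\Lambda(j)\cup\bigcup_{k=0}^{N-J-1}\Lambda'(J+k)$, where $\Lambda'(J+k)$ is any subset of $\Lambda(J+k)$ of cardinality $\lfloor 2^J(k+1)^{-3}\rfloor$, and let $\mathcal{M}=\bigcup_{J=0}^{N-1}\mathcal{M}_J$. For $m\in\mathcal{M}$ let $S_m$ be the linear span of $\{\phi_\lambda,\lambda\in m\}$, $D_m=\dim S_m$, and let $\hat s_m$ be the orthogonal projection of $X$ onto the space of $r\times n$ matrices all of whose lines belong to $S_m$. For $c>0$, the NEH estimator with penalty $\mathrm{pen}(m)=cD_m$ is $\tilde s=\hat s_{\hat m}$, where $\hat m$ is a minimizer over $m\in\mathcal{M}$ of $\|\hat s_m\|^2-2\langle X,\hat s_m\rangle+cD_m$. Classes. For $R>0$, $p\in(0,2]$ and $\alpha>1/p-1/2$, let $\mathcal{P}(R,\alpha,p)$ be the set of $r\times n$ matrices $s$, every column of which is a probability on $\{1,\dots,r\}$, such that the vectors $\beta_\lambda=(\langle s^{(j)},\phi_\lambda\rangle)_{1\le j\le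 r}$ satisfy $$\sum_{j=0}^{N-1}2^{jp(\alpha+1/2-1/p)}\sum_{\lambda\in\Lambda(j)}\|\beta_\lambda\|_r^p\le n^{p/2}R^p,$$ where $\|\cdot\|_r$ is the Euclidean norm of $\mathbb{R}^r$. Theorem. There is an absolute constant $c_0>0$ such that for every $c\ge c_0$, $p\in(0,2]$ and $\alpha>1/p-1/2$ there is a constant $C>0$, depending only on $\alpha$, $p$ and $c$, such that for all $N\ge1$ with $n=2^N$, all $r\ge 2$ and all $R>0$ with $n^\alpha>R$ and $nR^2\ge 1$, the NEH estimator $\tilde s$ with penalty $cD_m$ satisfies $$\sup_{s\in\mathcal{P}(R,\alpha,p)}\mathbb{E}_s\|s-\tilde s\|^2\le C\,(nR^2)^{1/(2\alpha+1)}.$$ -/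

import Mathlib

open MeasureTheory ProbabilityTheory

noncomputable section

namespace NEH

/-- Real `r × n` matrices, with the inner product `⟪t, t'⟫ = ∑ i j, t (j, i) * t' (j, i)` and the
associated norm. The entry in line `j` and column `i` of `t` is `t (j, i)`. -/
abbrev Mat (r n : ℕ) : Type := EuclideanSpace ℝ (Fin r × Fin n)

/-- The `j`-th line of a matrix. -/
def row {r n : ℕ} (t : Mat r n) (j : Fin r) : EuclideanSpace ℝ (Fin n) :=
  WithLp.toLp 2 fun i => t (j, i)

/-- The `i`-th column of a matrix. -/
def col {r n : ℕ} (t : Mat r n) (i : Fin n) : EuclideanSpace ℝ (Fin r) :=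
  WithLp.toLp 2 fun j => t (j, i)

/-- `ℝ^r ⊗ S`: the matrices all of whose lines belong to `S`. -/
def tensor (r : ℕ) {n : ℕ} (S : Submodule ℝ (EuclideanSpace ℝ (Fin n))) :
    Submodule ℝ (Mat r n) where
  carrier := {t | ∀ j, row t j ∈ S}
  add_mem' {a b} ha hb j := by
    have h : row (a + b) j = row a j + row b j := rfl
    rw [h]
    exact S.add_mem (ha j) (hb j)
  zero_mem' j := by
    have h : row (0 : Mat r n) j = 0 := rfl
    rw [h]
    exact S.zero_mem
  smul_mem' c a ha j := by
    have h : row (c • a) j = c • row a j := rfl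
    rw [h]
    exact S.smul_mem c (ha j)

/-- The random matrix `X` has independent columns, each of which is a vector of zeros and ones
with entries summing up to one, and the expectation of `X` is `s`. -/
structure IsMultinomialSample {Ω : Type*} [MeasurableSpace Ω] (P : Measure Ω) {r n : ℕ}
    (X : Ω → Mat r n) (s : Mat r n) : Prop where
  measurable : Measurable X
  zero_or_one : ∀ ω j i, X ω (j, i) = 0 ∨ X ω (j, i) = 1
  sum_eq_one : ∀ ω i, ∑ j, X ω (j, i) = 1
  indep : iIndepFun (fun i ω => col (X ω) i) P
  mean : ∀ j i, ∫ ω, X ω (j, i) ∂P = s (j, i)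

/-! ### The Haar basis of `ℝ^n`, `n = 2 ^ N` -/

/-- The index set `Λ(j) = {(j, k) : 0 ≤ k ≤ 2 ^ j - 1}` for `j ≥ 0`; moreover
`Λ(-1) = {(-1, 0)}`, because `(-1).toNat = 0`. -/
def level (j : ℤ) : Finset (ℤ × ℕ) := {j} ×ˢ Finset.range (2 ^ j.toNat)

/-- The mother Haar function: `1` on `(0, 1/2]`, `-1` on `(1/2, 1]`, and `0` elsewhere. -/
def mother (x : ℝ) : ℝ :=
  if 0 < x ∧ x ≤ 1 / 2 then 1 else if 1 / 2 < x ∧ x ≤ 1 then -1 else 0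

/-- The Haar vector `φ_λ` of `ℝ^n`, `n = 2 ^ N`. Coordinates are numbered from `0` here, so that
`i : Fin (2 ^ N)` stands for the coordinate `i + 1` of the range `1, …, n`. -/
def haar (N : ℕ) (l : ℤ × ℕ) : EuclideanSpace ℝ (Fin (2 ^ N)) :=
  WithLp.toLp 2 fun i =>
    if l.1 = -1 then 1 / √((2 : ℝ) ^ N)
    else (2 : ℝ) ^ ((l.1 : ℝ) / 2) / √((2 : ℝ) ^ N) *
      mother ((2 : ℝ) ^ l.1 * (((i : ℕ) + 1 : ℝ) / (2 : ℝ) ^ N) - (l.2 : ℝ))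

/-- The linear span `S_m` of the Haar vectors with index in `m`. -/
def model (N : ℕ) (m : Finset (ℤ × ℕ)) : Submodule ℝ (EuclideanSpace ℝ (Fin (2 ^ N))) :=
  Submodule.span ℝ (haar N '' (m : Set (ℤ × ℕ)))

/-- The collection `𝓜_J`: the index sets that contain `Λ(j)` for `-1 ≤ j ≤ J - 1`, together with a
subset `L k` of `Λ(J + k)` of cardinality `⌊2 ^ J (k + 1) ^ (-3)⌋` for `0 ≤ k ≤ N - J - 1`
(the division below is the rounded-down division of natural numbers). -/
def collectionAt (N J : ℕ) : Set (Finset (ℤ × ℕ)) :=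
  {m | ∃ L : ℕ → Finset (ℤ × ℕ),
    (∀ k < N - J, L k ⊆ level ((J : ℤ) + k) ∧ (L k).card = 2 ^ J / (k + 1) ^ 3) ∧
    m = (Finset.Ico (-1 : ℤ) J).biUnion level ∪ (Finset.range (N - J)).biUnion L}

/-- The collection `𝓜 = ⋃_{0 ≤ J ≤ N - 1} 𝓜_J`. -/
def collection (N : ℕ) : Set (Finset (ℤ × ℕ)) :=
  {m | ∃ J < N, m ∈ collectionAt N J}

/-! ### The penalized least-squares estimator -/

/-- The least-squares estimator over `ℝ^r ⊗ S_m`: the orthogonal projection of the observed matrix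
`x` onto `ℝ^r ⊗ S_m`. -/
def leastSquares {r N : ℕ} (m : Finset (ℤ × ℕ)) (x : Mat r (2 ^ N)) : Mat r (2 ^ N) :=
  (tensor r (model N m)).starProjection x

/-- The least-squares contrast `γ_n(t) = ‖t‖² - 2 ⟪x, t⟫` for the observed matrix `x`. -/
def contrast {r n : ℕ} (x t : Mat r n) : ℝ := ‖t‖ ^ 2 - 2 * inner ℝ x t

/-- The penalty `pen(m) = c * D_m`, where `D_m` is the dimension of `S_m`. -/
def penalty (c : ℝ) (N : ℕ) (m : Finset (ℤ × ℕ)) : ℝ :=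
  c * (Module.finrank ℝ (model N m) : ℝ)

/-- The penalized criterion `γ_n(ŝ_m) + pen(m)` for the observed matrix `x`. -/
def criterion (c : ℝ) {r N : ℕ} (x : Mat r (2 ^ N)) (m : Finset (ℤ × ℕ)) : ℝ :=
  contrast x (leastSquares m x) + penalty c N m

/-- `est` is a penalized least-squares estimator computed with the non-exhaustive Haar strategy with
penalty constant `c`: for every observed matrix `x` it is the least-squares estimator over
`ℝ^r ⊗ S_m` for an index set `m` (with any way of breaking ties) which minimizes the penalized
criterion over the collection. -/
def IsNEHEstimator (c : ℝ) {r N : ℕ} (est : Mat r (2 ^ N) → Mat r (2 ^ N)) : Prop :=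
  ∀ x, ∃ m ∈ collection N,
    (∀ m' ∈ collection N, criterion c x m ≤ criterion c x m') ∧ est x = leastSquares m x

/-! ### The Besov-type classes -/

/-- The vector `β_λ ∈ ℝ^r` of coefficients `β_λ^{(j)} = ⟪t^{(j)}, φ_λ⟫`. -/
def coeff {r N : ℕ} (t : Mat r (2 ^ N)) (l : ℤ × ℕ) : EuclideanSpace ℝ (Fin r) :=
  WithLp.toLp 2 fun j => inner ℝ (row t j) (haar N l)

/-- The Besov body `𝓑(R, α, p)`. -/
def besovBody (r N : ℕ) (R α p : ℝ) : Set (Mat r (2 ^ N)) :=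
  {t | ∑ j ∈ Finset.range N, (2 : ℝ) ^ ((j : ℝ) * p * (α + 1 / 2 - 1 / p)) *
      ∑ l ∈ level (j : ℤ), ‖coeff t l‖ ^ p ≤ ((2 : ℝ) ^ N) ^ (p / 2) * R ^ p}

/-- The class `𝓟(R, α, p)`: the matrices of `𝓑(R, α, p)` whose columns are probabilities. -/
def besovClass (r N : ℕ) (R α p : ℝ) : Set (Mat r (2 ^ N)) :=
  {s | s ∈ besovBody r N R α p ∧ ∀ i, (∀ j, 0 ≤ s (j, i)) ∧ ∑ j, s (j, i) = 1}

end NEH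

end

/-!
The proof is a model selection argument: an oracle inequality for the penalized estimator, followed
by an approximation bound over the Besov body.

*Deviations.* Write `ξ = X - s` and let `Π` be the orthogonal projection on `ℝ^r ⊗ S`, where `S` has
dimension `D`. The only probabilistic input is `𝔼 exp (‖Π ξ‖² / 8) ≤ exp (D / 2)`
(`IsMultinomialSample.integral_exp_norm_starProjection_sq_le`), which does not involve `r`. By
convexity `ξ` may be replaced by `X - X'` with `X'` an independent copy of `X`, and the columns of
`X - X'` may be given independent random signs. Given `X` and `X'` this leaves a Rademacher sum
`∑ ε_i u_i` in the Euclidean space `ℝ^r ⊗ S`, with `∑ ‖u_i‖² ≤ D / 2` and `∑ u_i u_iᵀ ≤ 1 / 2`.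
Such a sum satisfies `𝔼 exp (‖∑ ε_i u_i‖² / 2) ≤ exp (∑ ‖u_i‖²)`
(`sum_powerset_exp_norm_sq_le`): the signs are integrated out one at a time, and the quadratic form
in the exponent is updated as in the Gaussian case, by the Sherman–Morrison formula.

*Oracle inequality.* There are at most `exp (8 * 2 ^ J)` models in `𝓜_J` (`card_modelsAt_le`), and,
the Haar vectors being orthonormal (`inner_haar`), each of them has dimension at least `2 ^ J`.
Hence a union bound over all models costs a multiple of the dimension, which the penalty absorbs
as soon as `c ≥ 304`, and the risk is at most
`3 * ‖s - s_m‖² + 2 * (c + 16) * D_m + 128` for every model `m`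
(`IsMultinomialSample.integral_norm_sub_sq_le`).

*Approximation.* In `𝓜_J` one takes the model that keeps the largest coefficients of each level
`J + k`. A vector `a` with `∑ a_i ^ p ≤ B` has at most `B ^ (2 / p) * (d + 1) ^ (1 - 2 / p)` as the
sum of its squared entries beyond the `d` largest ones, and summing over `k` gives a squared bias
of order `n R² 2 ^ (-2 α J)` (`exists_mem_collectionAt_sum_le`); the series in `k` converges because
`α > 1 / p - 1 / 2`. The dimension is at most `3 * 2 ^ J`, so that the choice
`2 ^ J ≤ (n R²) ^ (1 / (2 α + 1)) < 2 ^ (J + 1)` balances the two terms. The conditions `n R² ≥ 1`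
and `R < n ^ α` say exactly that such a `J` exists with `0 ≤ J < N`.
-/

noncomputable section

namespace NEH

/-! ### Exponential moments of Rademacher sums -/

theorem exp_add_exp_neg_le (x a : ℝ) :
    Real.exp (a + x) + Real.exp (a - x) ≤ 2 * Real.exp (a + x ^ 2 / 2) := by
  have h := Real.cosh_le_exp_half_sq x
  rw [Real.cosh_eq] at h
  have e1 : Real.exp (a + x) = Real.exp a * Real.exp x := Real.exp_add a x
  have e2 : Real.exp (a - x) = Real.exp a * Real.exp (-x) := by rw [← Real.exp_add]; rfl
  rw [e1, e2, Real.exp_add]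
  have := mul_le_mul_of_nonneg_left h (Real.exp_pos a).le
  linarith

/-- Exponential moment of a Rademacher sum in a Euclidean space: the sum over `A` is `2 ^ s.card` times
the expectation over independent signs `ε_i`, with `ε_i = 1` for `i ∈ A`. With
`T = 1 - ∑ i ∈ s, u_i u_iᵀ`, the bound reads
`𝔼 exp (‖T z + ∑ ε_i u_i‖² / 2) ≤ exp (⟪T z, z⟫ / 2 + ∑ ‖u_i‖²)`. Only `z = 0` is of interest in the
end; writing the shift as `T z` makes the induction go through without inverting `T`. -/
theorem sum_powerset_exp_norm_sq_le {E ι : Type*} [NormedAddCommGroup E] [InnerProductSpace ℝ E]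
    [FiniteDimensional ℝ E] [DecidableEq ι] (u : ι → E) (s : Finset ι)
    (h : ∀ t : E, ∑ i ∈ s, inner ℝ (u i) t ^ 2 ≤ ‖t‖ ^ 2 / 2) (z : E) :
    ∑ A ∈ s.powerset, Real.exp (‖z - ∑ i ∈ s, inner ℝ (u i) z • u i +
        ∑ i ∈ s, (if i ∈ A then u i else -u i)‖ ^ 2 / 2) ≤
      2 ^ s.card * Real.exp ((‖z‖ ^ 2 - ∑ i ∈ s, inner ℝ (u i) z ^ 2) / 2 +
        ∑ i ∈ s, ‖u i‖ ^ 2) := by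
  induction s using Finset.induction_on generalizing z with
  | empty => simp
  | insert a s ha ih =>
    have hs : ∀ t : E, ∑ i ∈ s, inner ℝ (u i) t ^ 2 ≤ ‖t‖ ^ 2 / 2 := fun t => by
      have := h t
      rw [Finset.sum_insert ha] at this
      nlinarith [sq_nonneg (inner ℝ (u a) t)]
    specialize ih hs
    let T : E →ₗ[ℝ] E := LinearMap.id - ∑ i ∈ s, (innerₛₗ ℝ (u i)).smulRight (u i)
    have hT : ∀ x, T x = x - ∑ i ∈ s, inner ℝ (u i) x • u i := fun x => by
      simp [T, LinearMap.sum_apply]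
    have hTi : ∀ x y, inner ℝ (T x) y = inner ℝ x y - ∑ i ∈ s, inner ℝ (u i) x * inner ℝ (u i) y :=
      fun x y => by rw [hT, inner_sub_left, sum_inner]; simp [real_inner_smul_left]
    have hTq : ∀ x, inner ℝ (T x) x = ‖x‖ ^ 2 - ∑ i ∈ s, inner ℝ (u i) x ^ 2 := fun x => by
      rw [hTi, real_inner_self_eq_norm_sq]; simp [sq]
    have hpos : ∀ x, ‖x‖ ^ 2 / 2 ≤ inner ℝ (T x) x := fun x => by
      rw [hTq]; linarith [hs x]
    have hinj : Function.Injective T := by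
      rw [injective_iff_map_eq_zero]
      intro x hx
      have := hpos x
      rw [hx, inner_zero_left] at this
      have h0 : ‖x‖ ^ 2 = 0 := le_antisymm (by linarith) (sq_nonneg _)
      simpa using h0
    -- `w = T⁻¹ u_a`; shifting by `± u_a` amounts to moving `z` along `w`.
    obtain ⟨w, hw⟩ := LinearMap.surjective_of_injective hinj (u a)
    set β := inner ℝ (u a) w with hβ
    have hβw : ‖w‖ ^ 2 / 2 ≤ β := by have := hpos w; rwa [hw] at this
    have hβ0 : 0 ≤ β := le_trans (by positivity) hβw
    have hβu : β ≤ 2 * ‖u a‖ ^ 2 := by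
      have h1 : β ≤ ‖u a‖ * ‖w‖ := real_inner_le_norm _ _
      nlinarith [sq_nonneg (2 * ‖u a‖ - ‖w‖)]
    -- The bound `1 / 2` on the operator `∑ u_i u_iᵀ` serves here: it gives `‖u a‖² ≤ 1 / 2`.
    have hβ1 : β ≤ 1 := by
      have h1 := h (u a)
      rw [Finset.sum_insert ha, real_inner_self_eq_norm_sq] at h1
      have h2 : 0 ≤ ∑ i ∈ s, inner ℝ (u i) (u a) ^ 2 := Finset.sum_nonneg fun i _ => sq_nonneg _
      nlinarith [sq_nonneg (‖u a‖ ^ 2)]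
    set b := inner ℝ (u a) z with hb
    have hzw : inner ℝ (T z) w = b := by
      rw [hTi, hb, ← hw, hTi, real_inner_comm]
      simp [mul_comm]
    have hquad : ∀ κ : ℝ, inner ℝ (T (z + κ • w)) (z + κ • w) =
        inner ℝ (T z) z + 2 * κ * b + κ ^ 2 * β := fun κ => by
      rw [map_add, map_smul, hw, inner_add_left, inner_add_right, inner_add_right,
        real_inner_smul_left, real_inner_smul_left, real_inner_smul_right, real_inner_smul_right,
        hzw]
      simp only [← hb, ← hβ]
      ring
    have hshift : ∀ ε : ℝ, T z - b • u a + ε • u a = T (z + (ε - b) • w) := fun ε => by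
      rw [map_add, map_smul, hw, sub_smul]; abel
    have key : ∀ ε : ℝ, ∑ A ∈ s.powerset, Real.exp (‖T z - b • u a + ε • u a +
        ∑ i ∈ s, (if i ∈ A then u i else -u i)‖ ^ 2 / 2) ≤
        2 ^ s.card * Real.exp ((inner ℝ (T z) z + 2 * (ε - b) * b + (ε - b) ^ 2 * β) / 2 +
        ∑ i ∈ s, ‖u i‖ ^ 2) := fun ε => by
      rw [hshift, ← hquad, hTq, hT]
      exact ih _
    have hz : z - ∑ i ∈ insert a s, inner ℝ (u i) z • u i = T z - b • u a := by
      rw [Finset.sum_insert ha, hT]; abel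
    rw [Finset.sum_powerset_insert ha, hz, Finset.sum_insert ha, Finset.sum_insert ha,
      Finset.card_insert_of_notMem ha]
    have e1 : ∑ A ∈ s.powerset, Real.exp (‖T z - b • u a +
          ∑ i ∈ insert a s, (if i ∈ A then u i else -u i)‖ ^ 2 / 2) =
        ∑ A ∈ s.powerset, Real.exp (‖T z - b • u a + (-1 : ℝ) • u a +
          ∑ i ∈ s, (if i ∈ A then u i else -u i)‖ ^ 2 / 2) := by
      refine Finset.sum_congr rfl fun A hA => ?_
      have haA : a ∉ A := fun hA' => ha (Finset.mem_powerset.1 hA hA')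
      rw [Finset.sum_insert ha, if_neg haA, neg_one_smul, add_assoc]
    have e2 : ∑ A ∈ s.powerset, Real.exp (‖T z - b • u a +
          ∑ i ∈ insert a s, (if i ∈ insert a A then u i else -u i)‖ ^ 2 / 2) =
        ∑ A ∈ s.powerset, Real.exp (‖T z - b • u a + (1 : ℝ) • u a +
          ∑ i ∈ s, (if i ∈ A then u i else -u i)‖ ^ 2 / 2) := by
      refine Finset.sum_congr rfl fun A hA => ?_
      rw [Finset.sum_insert ha, if_pos (Finset.mem_insert_self a A), one_smul, add_assoc]
      have hsum : ∑ i ∈ s, (if i ∈ insert a A then u i else -u i) =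
          ∑ i ∈ s, (if i ∈ A then u i else -u i) := by
        refine Finset.sum_congr rfl fun i hi => ?_
        have hia : i ≠ a := fun hia => ha (hia ▸ hi)
        simp [Finset.mem_insert, hia]
      rw [hsum]
    rw [e1, e2]
    refine (add_le_add (key (-1)) (key 1)).trans ?_
    rw [← mul_add ((2 : ℝ) ^ s.card), pow_succ (2 : ℝ) s.card, mul_assoc ((2 : ℝ) ^ s.card)]
    refine mul_le_mul_of_nonneg_left ?_ (by positivity)
    have hc := exp_add_exp_neg_le (b * (1 - β)) ((inner ℝ (T z) z - 2 * b ^ 2 + β + b ^ 2 * β) / 2 +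
      ∑ i ∈ s, ‖u i‖ ^ 2)
    rw [add_comm (Real.exp _) (Real.exp _)]
    refine le_trans (le_of_eq ?_) (hc.trans ?_)
    · congr 2 <;> ring
    · refine mul_le_mul_of_nonneg_left (Real.exp_le_exp.2 ?_) (by norm_num)
      have hTz := hTq z
      have hb2 : 0 ≤ b ^ 2 * β * (1 - β) :=
        mul_nonneg (mul_nonneg (sq_nonneg b) hβ0) (by linarith)
      nlinarith

/-! ### Projections on tensor spaces and the law of the sample -/

theorem norm_sq_eq_sum_row {r n : ℕ} (t : Mat r n) : ‖t‖ ^ 2 = ∑ j, ‖row t j‖ ^ 2 := by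
  simp only [EuclideanSpace.real_norm_sq_eq, Fintype.sum_prod_type, row]

theorem inner_eq_sum_row {r n : ℕ} (t t' : Mat r n) :
    inner ℝ t t' = ∑ j, inner ℝ (row t j) (row t' j) := by
  simp only [PiLp.inner_apply, Fintype.sum_prod_type, row]

theorem norm_sq_eq_sum_col {r n : ℕ} (t : Mat r n) : ‖t‖ ^ 2 = ∑ i, ‖col t i‖ ^ 2 := by
  simp only [EuclideanSpace.real_norm_sq_eq, Fintype.sum_prod_type_right, col]

theorem row_starProjection_tensor {r n : ℕ} (S : Submodule ℝ (EuclideanSpace ℝ (Fin n)))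
    (t : Mat r n) (j : Fin r) :
    row ((tensor r S).starProjection t) j = S.starProjection (row t j) := by
  have h : (tensor r S).starProjection t =
      WithLp.toLp 2 fun q : Fin r × Fin n => S.starProjection (row t q.1) q.2 := by
    refine Submodule.eq_starProjection_of_mem_of_inner_eq_zero
      (fun j => S.starProjection_apply_mem (row t j)) fun w hw => ?_
    rw [inner_eq_sum_row]
    exact Finset.sum_eq_zero fun j _ => S.starProjection_inner_eq_zero (row t j) _ (hw j)
  rw [h]
  rfl

/-- The trace of an orthogonal projection is the dimension of its range. -/
theorem sum_norm_starProjection_single_sq {n : ℕ} (S : Submodule ℝ (EuclideanSpace ℝ (Fin n))) :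
    ∑ i, ‖S.starProjection (EuclideanSpace.single i 1)‖ ^ 2 = Module.finrank ℝ S := by
  let b := stdOrthonormalBasis ℝ S
  have h1 : ∀ v, ‖S.starProjection v‖ ^ 2 =
      ∑ a, inner ℝ (b a : EuclideanSpace ℝ (Fin n)) v ^ 2 := fun v => by
    rw [Submodule.starProjection_apply, ← Submodule.coe_norm, ← b.sum_sq_norm_inner_right]
    refine Finset.sum_congr rfl fun a _ => ?_
    rw [Submodule.inner_orthogonalProjectionOnto_eq_of_mem_left, Real.norm_eq_abs, sq_abs]
  simp_rw [h1]
  rw [Finset.sum_comm]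
  have h2 : ∀ a, ∑ i, inner ℝ (b a : EuclideanSpace ℝ (Fin n)) (EuclideanSpace.single i 1) ^ 2
      = 1 := fun a => by
    have h3 : ‖(b a : EuclideanSpace ℝ (Fin n))‖ ^ 2 = 1 := by
      have := b.orthonormal.1 a
      rw [← Submodule.coe_norm, this, one_pow]
    refine Eq.trans ?_ h3
    rw [EuclideanSpace.real_norm_sq_eq]
    refine Finset.sum_congr rfl fun i _ => ?_
    simp [EuclideanSpace.inner_single_right]
  simp [h2]

/-- The matrix whose `i`-th column is `v` and whose other columns vanish. -/
def singleCol {r n : ℕ} (i : Fin n) (v : EuclideanSpace ℝ (Fin r)) : Mat r n :=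
  WithLp.toLp 2 fun q => if q.2 = i then v q.1 else 0

theorem norm_starProjection_singleCol_sq {r n : ℕ} (S : Submodule ℝ (EuclideanSpace ℝ (Fin n)))
    (i : Fin n) (v : EuclideanSpace ℝ (Fin r)) :
    ‖(tensor r S).starProjection (singleCol i v)‖ ^ 2 =
      ‖v‖ ^ 2 * ‖S.starProjection (EuclideanSpace.single i 1)‖ ^ 2 := by
  have h : ∀ j, row (singleCol i v) j = v j • EuclideanSpace.single i (1 : ℝ) := fun j => by
    ext l
    simp [row, singleCol]
  rw [norm_sq_eq_sum_row, EuclideanSpace.real_norm_sq_eq, Finset.sum_mul]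
  refine Finset.sum_congr rfl fun j _ => ?_
  rw [row_starProjection_tensor, h, map_smul, norm_smul, mul_pow, Real.norm_eq_abs, sq_abs]

theorem inner_singleCol {r n : ℕ} (i : Fin n) (v : EuclideanSpace ℝ (Fin r)) (t : Mat r n) :
    inner ℝ (singleCol i v) t = inner ℝ v (col t i) := by
  simp only [PiLp.inner_apply, Fintype.sum_prod_type, singleCol, col]
  simp

theorem sum_singleCol_col {r n : ℕ} (t : Mat r n) : ∑ i, singleCol i (col t i) = t := by
  ext q
  simp [singleCol, col, WithLp.ofLp_sum]

/-- Exponential moment of the projection on `ℝ^r ⊗ S` of a matrix with fixed columns `v i` which are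
given independent random signs. -/
theorem sum_powerset_exp_starProjection_le {r n : ℕ}
    (S : Submodule ℝ (EuclideanSpace ℝ (Fin n))) (v : Fin n → EuclideanSpace ℝ (Fin r))
    (hv : ∀ i, ‖v i‖ ^ 2 ≤ 2) :
    ∑ A ∈ (Finset.univ : Finset (Fin n)).powerset, Real.exp (‖(tensor r S).starProjection
      (∑ i, singleCol i (if i ∈ A then v i else -v i))‖ ^ 2 / 8) ≤
      2 ^ n * Real.exp ((Module.finrank ℝ S : ℝ) / 2) := by
  set Q := (tensor r S).starProjection
  -- The factor `1 / 2` turns the bound `‖v i‖ ^ 2 ≤ 2` into the bound `1 / 2` on the operator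
  -- `∑ u_i u_iᵀ` of the Rademacher sum.
  have h := sum_powerset_exp_norm_sq_le
    (fun i => (1 / 2 : ℝ) • Q (singleCol i (v i))) Finset.univ (fun t => ?_) 0
  · simp only [sub_self, zero_add, norm_zero, inner_zero_right, Finset.card_univ,
      Fintype.card_fin, zero_smul, Finset.sum_const_zero, ne_eq, OfNat.ofNat_ne_zero,
      not_false_eq_true, zero_pow, zero_div] at h
    refine le_trans (le_of_eq ?_) (h.trans ?_)
    · refine Finset.sum_congr rfl fun A _ => ?_
      have e : ∑ i, (if i ∈ A then (1 / 2 : ℝ) • Q (singleCol i (v i))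
          else -((1 / 2 : ℝ) • Q (singleCol i (v i)))) =
          (1 / 2 : ℝ) • Q (∑ i, singleCol i (if i ∈ A then v i else -v i)) := by
        rw [map_sum, Finset.smul_sum]
        refine Finset.sum_congr rfl fun i _ => ?_
        split_ifs
        · rfl
        · rw [← smul_neg, ← map_neg]
          congr 2
          ext q
          simp only [singleCol, PiLp.neg_apply]
          split_ifs <;> simp
      rw [e, norm_smul, mul_pow]
      congr 1
      norm_num
      ring
    · refine mul_le_mul_of_nonneg_left (Real.exp_le_exp.2 ?_) (by positivity)
      rw [← sum_norm_starProjection_single_sq, Finset.sum_div]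
      refine Finset.sum_le_sum fun i _ => ?_
      rw [norm_smul, mul_pow, norm_starProjection_singleCol_sq]
      norm_num
      nlinarith [hv i, sq_nonneg ‖S.starProjection (EuclideanSpace.single i 1)‖]
  · have h1 : ∀ i, inner ℝ ((1 / 2 : ℝ) • Q (singleCol i (v i))) t ^ 2 ≤
        ‖col (Q t) i‖ ^ 2 / 2 := fun i => by
      rw [real_inner_smul_left, Submodule.inner_starProjection_left_eq_right, inner_singleCol,
        mul_pow]
      have h2 := abs_real_inner_le_norm (v i) (col (Q t) i)
      have h3 := pow_le_pow_left₀ (abs_nonneg _) h2 2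
      rw [sq_abs, mul_pow] at h3
      nlinarith [hv i, sq_nonneg ‖col (Q t) i‖]
    refine (Finset.sum_le_sum fun i _ => h1 i).trans ?_
    rw [← Finset.sum_div, ← norm_sq_eq_sum_col]
    have := (tensor r S).norm_starProjection_apply_le t
    gcongr

/-- The zero-one matrix whose `i`-th column is the `k i`-th basis vector of `ℝ^r`. -/
def pointMat {r n : ℕ} (k : Fin n → Fin r) : Mat r n :=
  WithLp.toLp 2 fun q => if k q.2 = q.1 then 1 else 0

namespace IsMultinomialSample

variable {Ω : Type*} [MeasurableSpace Ω] {P : Measure Ω} {r n : ℕ}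
  {X : Ω → Mat r n} {s : Mat r n}

theorem measurable_apply (hX : IsMultinomialSample P X s) (q : Fin r × Fin n) :
    Measurable fun ω => X ω q := by
  have h : Measurable fun t : Mat r n => t q := by fun_prop
  exact h.comp hX.measurable

theorem eq_pointMat_iff (hX : IsMultinomialSample P X s) (k : Fin n → Fin r) (ω : Ω) :
    X ω = pointMat k ↔ ∀ i, X ω (k i, i) = 1 := by
  constructor
  · intro h i
    simp [h, pointMat]
  · intro h
    ext q
    obtain ⟨j, i⟩ := q
    simp only [pointMat]
    split_ifs with hj
    · rw [← hj, h]
    · have h1 := hX.sum_eq_one ω i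
      rw [← Finset.add_sum_erase _ _ (Finset.mem_univ (k i)), h i] at h1
      have h2 : ∑ j ∈ Finset.univ.erase (k i), X ω (j, i) = 0 := by linarith
      rw [Finset.sum_eq_zero_iff_of_nonneg] at h2
      · exact h2 j (Finset.mem_erase.2 ⟨fun h => hj h.symm, Finset.mem_univ j⟩)
      · intro j _
        rcases hX.zero_or_one ω j i with h | h <;> simp [h]

theorem exists_eq_pointMat (hX : IsMultinomialSample P X s) (ω : Ω) :
    ∃ k, X ω = pointMat k := by
  have h : ∀ i, ∃ j, X ω (j, i) = 1 := fun i => by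
    by_contra! hne
    have h0 : ∀ j, X ω (j, i) = 0 := fun j => (hX.zero_or_one ω j i).resolve_right (hne j)
    have := hX.sum_eq_one ω i
    simp [h0] at this
  choose k hk using h
  exact ⟨k, (hX.eq_pointMat_iff k ω).2 hk⟩

theorem real_apply_eq_one (hX : IsMultinomialSample P X s) (j : Fin r) (i : Fin n) :
    P.real {ω | X ω (j, i) = 1} = s (j, i) := by
  have hm : MeasurableSet {ω | X ω (j, i) = 1} :=
    hX.measurable_apply (j, i) (measurableSet_singleton 1)
  rw [← hX.mean, ← integral_indicator_one hm]
  congr 1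
  ext ω
  by_cases h : X ω (j, i) = 1
  · simp [h]
  · simp [(hX.zero_or_one ω j i).resolve_right h]

theorem mean_nonneg (hX : IsMultinomialSample P X s) (j : Fin r) (i : Fin n) : 0 ≤ s (j, i) := by
  rw [← hX.real_apply_eq_one]
  exact measureReal_nonneg

theorem real_eq_pointMat (hX : IsMultinomialSample P X s) (k : Fin n → Fin r) :
    P.real {ω | X ω = pointMat k} = ∏ i, s (k i, i) := by
  have h1 : {ω | X ω = pointMat k} =
      ⋂ i ∈ (Finset.univ : Finset (Fin n)), (fun ω => col (X ω) i) ⁻¹' {v | v (k i) = 1} := by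
    ext ω
    simp [hX.eq_pointMat_iff, col]
  have hm : ∀ i, MeasurableSet {v : EuclideanSpace ℝ (Fin r) | v (k i) = 1} := fun i => by
    have h : Measurable fun t : EuclideanSpace ℝ (Fin r) => t (k i) := by fun_prop
    exact h (measurableSet_singleton 1)
  rw [h1, measureReal_def, hX.indep.measure_inter_preimage_eq_mul Finset.univ fun i _ => hm i,
    ENNReal.toReal_prod]
  exact Finset.prod_congr rfl fun i _ => hX.real_apply_eq_one (k i) i

theorem comp_eq_sum_indicator (hX : IsMultinomialSample P X s) (f : Mat r n → ℝ) (ω : Ω) :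
    f (X ω) = ∑ k : Fin n → Fin r,
      Set.indicator {ω | X ω = pointMat k} (fun _ => f (pointMat k)) ω := by
  obtain ⟨k, hk⟩ := hX.exists_eq_pointMat ω
  rw [Finset.sum_eq_single k]
  · simp [hk]
  · intro l _ hl
    refine Set.indicator_of_notMem (fun h => hl ?_) _
    have h' : X ω = pointMat l := h
    rw [hX.eq_pointMat_iff] at h'
    funext i
    have := h' i
    rw [hk] at this
    by_contra hne
    simp [pointMat, Ne.symm hne] at this
  · simp

theorem measurableSet_eq_pointMat (hX : IsMultinomialSample P X s) (k : Fin n → Fin r) :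
    MeasurableSet {ω | X ω = pointMat k} :=
  hX.measurable (measurableSet_singleton (pointMat k))

theorem integrable_comp [IsProbabilityMeasure P] (hX : IsMultinomialSample P X s) (f : Mat r n → ℝ) :
    Integrable (fun ω => f (X ω)) P := by
  simp_rw [hX.comp_eq_sum_indicator f]
  exact integrable_finsetSum _ fun k _ =>
    (integrable_const _).indicator (hX.measurableSet_eq_pointMat k)

/-- The sample takes the value `pointMat k` with probability `∏ i, s (k i, i)`, so that expectations
are finite sums. -/
theorem integral_comp [IsProbabilityMeasure P] (hX : IsMultinomialSample P X s) (f : Mat r n → ℝ) :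
    ∫ ω, f (X ω) ∂P = ∑ k : Fin n → Fin r, (∏ i, s (k i, i)) * f (pointMat k) := by
  simp_rw [hX.comp_eq_sum_indicator f]
  rw [integral_finsetSum _ fun k _ =>
    (integrable_const _).indicator (hX.measurableSet_eq_pointMat k)]
  refine Finset.sum_congr rfl fun k _ => ?_
  rw [integral_indicator_const _ (hX.measurableSet_eq_pointMat k), hX.real_eq_pointMat, smul_eq_mul]

end IsMultinomialSample

/-! ### Symmetrization -/

theorem norm_col_pointMat_sub_sq_le {r n : ℕ} (k l : Fin n → Fin r) (i : Fin n) :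
    ‖col (pointMat k - pointMat l) i‖ ^ 2 ≤ 2 := by
  rw [EuclideanSpace.real_norm_sq_eq]
  have h : ∀ j, (col (pointMat k - pointMat l) i) j ^ 2 ≤
      (if k i = j then 1 else 0) + (if l i = j then 1 else 0) := fun j => by
    simp only [col, pointMat, PiLp.sub_apply]
    split_ifs <;> norm_num
  refine (Finset.sum_le_sum fun j _ => h j).trans ?_
  rw [Finset.sum_add_distrib]
  norm_num

theorem convexOn_exp_norm_starProjection_sq {E : Type*} [NormedAddCommGroup E]
    [InnerProductSpace ℝ E] (U : Submodule ℝ E) [U.HasOrthogonalProjection] :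
    ConvexOn ℝ Set.univ fun x => Real.exp (‖U.starProjection x‖ ^ 2 / 8) := by
  have h1 : ConvexOn ℝ Set.univ fun x => ‖U.starProjection x‖ :=
    (convexOn_norm (E := E) convex_univ).comp_linearMap U.starProjection.toLinearMap
  have h2 := (h1.pow (fun _ _ => norm_nonneg _) 2).smul (show (0 : ℝ) ≤ 1 / 8 by norm_num)
  refine ⟨convex_univ, fun x hx y hy a b ha hb hab => ?_⟩
  refine le_trans (Real.exp_le_exp.2 ?_) (convexOn_exp.2 trivial trivial ha hb hab)
  have h3 := h2.2 hx hy ha hb hab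
  simpa [div_eq_inv_mul] using h3

/-- Two independent families `q.1`, `q.2` of independent variables, with common law of weights
`a · i` at `i`, can be exchanged on any set `A` of indices without changing expectations. -/
theorem sum_prod_mul_prod_eq_swap {ι κ : Type*} [Fintype ι] [DecidableEq ι] [Fintype κ]
    (a : κ → ι → ℝ) (A : Finset ι) (G : (ι → κ) → (ι → κ) → ℝ) :
    ∑ q : (ι → κ) × (ι → κ), (∏ i, a (q.1 i) i) * (∏ i, a (q.2 i) i) *
        G (A.piecewise q.1 q.2) (A.piecewise q.2 q.1) =
      ∑ q : (ι → κ) × (ι → κ), (∏ i, a (q.1 i) i) * (∏ i, a (q.2 i) i) * G q.1 q.2 := by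
  let e : (ι → κ) × (ι → κ) → (ι → κ) × (ι → κ) := fun q =>
    (A.piecewise q.1 q.2, A.piecewise q.2 q.1)
  have he : Function.Involutive e := fun q => by
    refine Prod.ext ?_ ?_ <;> funext i <;> by_cases hi : i ∈ A <;> simp [e, hi]
  refine Fintype.sum_equiv he.toPerm _ _ fun q => ?_
  have h : (∏ i, a (q.1 i) i) * (∏ i, a (q.2 i) i) =
      (∏ i, a ((e q).1 i) i) * (∏ i, a ((e q).2 i) i) := by
    rw [← Finset.prod_mul_distrib, ← Finset.prod_mul_distrib]
    refine Finset.prod_congr rfl fun i _ => ?_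
    by_cases hi : i ∈ A <;> simp [e, hi, mul_comm]
  rw [h]
  rfl

/-- The squared norm of the noise projected on `ℝ^r ⊗ S` has an exponential moment governed by the
dimension of `S` alone, whatever the number `r` of lines. -/
theorem IsMultinomialSample.integral_exp_norm_starProjection_sq_le
    {Ω : Type*} [MeasurableSpace Ω] {P : Measure Ω} [IsProbabilityMeasure P] {r n : ℕ}
    {X : Ω → Mat r n} {s : Mat r n} (hX : IsMultinomialSample P X s)
    (S : Submodule ℝ (EuclideanSpace ℝ (Fin n))) :
    ∫ ω, Real.exp (‖(tensor r S).starProjection (X ω - s)‖ ^ 2 / 8) ∂P ≤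
      Real.exp ((Module.finrank ℝ S : ℝ) / 2) := by
  set F : Mat r n → ℝ := fun x => Real.exp (‖(tensor r S).starProjection x‖ ^ 2 / 8) with hF
  set p : (Fin n → Fin r) → ℝ := fun k => ∏ i, s (k i, i) with hp
  have hp0 : ∀ k, 0 ≤ p k := fun k => Finset.prod_nonneg fun i _ => hX.mean_nonneg _ _
  have hp1 : ∑ k, p k = 1 := by
    have := hX.integral_comp fun _ => 1
    simpa using this.symm
  have hs : ∑ l, p l • pointMat l = s := by
    ext q
    obtain ⟨j, i⟩ := q
    have h := hX.integral_comp fun t => t (j, i)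
    rw [hX.mean] at h
    simp [h, WithLp.ofLp_sum]
    rfl
  have hjensen : ∀ k, F (pointMat k - s) ≤ ∑ l, p l * F (pointMat k - pointMat l) := fun k => by
    have h := (convexOn_exp_norm_starProjection_sq (tensor r S)).map_sum_le
      (t := Finset.univ) (w := p) (p := fun l => pointMat k - pointMat l)
      (fun l _ => hp0 l) hp1 fun l _ => Set.mem_univ _
    have e : ∑ l, p l • (pointMat k - pointMat l) = pointMat k - s := by
      simp_rw [smul_sub]
      rw [Finset.sum_sub_distrib, ← Finset.sum_smul, hp1, one_smul, hs]
    rw [e] at h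
    exact h
  set v : (Fin n → Fin r) × (Fin n → Fin r) → Fin n → EuclideanSpace ℝ (Fin r) :=
    fun q i => col (pointMat q.1 - pointMat q.2) i with hv
  have hsym : ∀ A : Finset (Fin n), ∑ q : (Fin n → Fin r) × (Fin n → Fin r),
      p q.1 * p q.2 * F (∑ i, singleCol i (if i ∈ A then v q i else -v q i)) =
      ∑ q : (Fin n → Fin r) × (Fin n → Fin r), p q.1 * p q.2 * F (pointMat q.1 - pointMat q.2) :=
    fun A => by
      rw [← sum_prod_mul_prod_eq_swap (fun j i => s (j, i)) A
        fun k l => F (pointMat k - pointMat l)]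
      refine Finset.sum_congr rfl fun q _ => ?_
      congr 2
      rw [← sum_singleCol_col (pointMat (A.piecewise q.1 q.2) - pointMat (A.piecewise q.2 q.1))]
      refine Finset.sum_congr rfl fun i _ => ?_
      congr 1
      ext j
      by_cases hi : i ∈ A <;> simp [hv, hi, col, pointMat]
  have hle : (2 : ℝ) ^ n * ∑ q : (Fin n → Fin r) × (Fin n → Fin r),
      p q.1 * p q.2 * F (pointMat q.1 - pointMat q.2) ≤
      2 ^ n * Real.exp ((Module.finrank ℝ S : ℝ) / 2) := by
    calc _ = ∑ A ∈ (Finset.univ : Finset (Fin n)).powerset,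
          ∑ q : (Fin n → Fin r) × (Fin n → Fin r),
          p q.1 * p q.2 * F (∑ i, singleCol i (if i ∈ A then v q i else -v q i)) := by
          rw [Finset.sum_congr rfl fun A _ => hsym A]
          simp
      _ = ∑ q : (Fin n → Fin r) × (Fin n → Fin r), p q.1 * p q.2 *
          ∑ A ∈ (Finset.univ : Finset (Fin n)).powerset,
            F (∑ i, singleCol i (if i ∈ A then v q i else -v q i)) := by
          rw [Finset.sum_comm]
          simp_rw [Finset.mul_sum]
      _ ≤ ∑ q : (Fin n → Fin r) × (Fin n → Fin r), p q.1 * p q.2 *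
          (2 ^ n * Real.exp ((Module.finrank ℝ S : ℝ) / 2)) := by
          refine Finset.sum_le_sum fun q _ => mul_le_mul_of_nonneg_left
            (sum_powerset_exp_starProjection_le S (v q)
              fun i => norm_col_pointMat_sub_sq_le q.1 q.2 i) (mul_nonneg (hp0 _) (hp0 _))
      _ = _ := by
          rw [← Finset.sum_mul, Fintype.sum_prod_type]
          simp_rw [← Finset.mul_sum, hp1, mul_one, hp1, one_mul]
  calc ∫ ω, F (X ω - s) ∂P = ∑ k, p k * F (pointMat k - s) := hX.integral_comp fun t => F (t - s)
    _ ≤ ∑ k, p k * ∑ l, p l * F (pointMat k - pointMat l) :=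
        Finset.sum_le_sum fun k _ => mul_le_mul_of_nonneg_left (hjensen k) (hp0 k)
    _ = ∑ q : (Fin n → Fin r) × (Fin n → Fin r),
        p q.1 * p q.2 * F (pointMat q.1 - pointMat q.2) := by
        rw [Fintype.sum_prod_type]
        simp_rw [Finset.mul_sum, mul_assoc]
    _ ≤ _ := le_of_mul_le_mul_left hle (by positivity)

/-! ### The Haar basis -/

/-- The wavelet with steps of length `h` and position `k`: as a function of `i` it is `1` on the
block `i / h = 2 * k`, `-1` on the next block, and `0` elsewhere. -/
def wave (h k i : ℕ) : ℝ :=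
  (if i / h = 2 * k then 1 else 0) - (if i / h = 2 * k + 1 then 1 else 0)

theorem natDiv_eq_iff {h : ℕ} (hh : 0 < h) (i q : ℕ) :
    i / h = q ↔ q * h ≤ i ∧ i < (q + 1) * h := by
  rw [Nat.div_eq_iff hh, add_mul, one_mul]
  omega

/-- The support of `wave h k` is the block of length `2 * h` and position `k`. -/
theorem wave_eq_zero {h k i : ℕ} (hi : i / (2 * h) ≠ k) : wave h k i = 0 := by
  rw [mul_comm, ← Nat.div_div_eq_div_mul] at hi
  rw [wave, if_neg (by omega), if_neg (by omega), sub_zero]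

theorem sum_ite_div_eq {h n : ℕ} (q : ℕ) (hh : 0 < h) (hq : (q + 1) * h ≤ n) :
    ∑ i : Fin n, (if (i : ℕ) / h = q then (1 : ℝ) else 0) = h := by
  rw [Fin.sum_univ_eq_sum_range fun i => if i / h = q then (1 : ℝ) else 0, Finset.sum_boole]
  have : (Finset.range n).filter (fun i => i / h = q) = Finset.Ico (q * h) ((q + 1) * h) := by
    ext i
    simp only [Finset.mem_filter, Finset.mem_range, Finset.mem_Ico, natDiv_eq_iff hh]
    exact ⟨fun H => H.2, fun H => ⟨H.2.trans_le hq, H⟩⟩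
  rw [this, Nat.card_Ico]
  congr 1
  rw [add_mul, one_mul, Nat.add_sub_cancel_left]

theorem sum_wave {h k n : ℕ} (hh : 0 < h) (hk : (k + 1) * (2 * h) ≤ n) :
    ∑ i : Fin n, wave h k i = 0 := by
  simp only [wave]
  rw [Finset.sum_sub_distrib, sum_ite_div_eq _ hh (by nlinarith), sum_ite_div_eq _ hh (by nlinarith),
    sub_self]

/-- A wavelet is orthogonal to the functions that are constant on its support. -/
theorem sum_mul_wave {h k n : ℕ} (hh : 0 < h) (hk : (k + 1) * (2 * h) ≤ n) (g : ℕ → ℝ) :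
    ∑ i : Fin n, g ((i : ℕ) / (2 * h)) * wave h k i = 0 := by
  have e : ∀ i : Fin n, g ((i : ℕ) / (2 * h)) * wave h k i = g k * wave h k i := fun i => by
    by_cases hi : (i : ℕ) / (2 * h) = k
    · rw [hi]
    · rw [wave_eq_zero hi, mul_zero, mul_zero]
  simp_rw [e]
  rw [← Finset.mul_sum, sum_wave hh hk, mul_zero]

theorem sum_wave_sq {h k n : ℕ} (hh : 0 < h) (hk : (k + 1) * (2 * h) ≤ n) :
    ∑ i : Fin n, wave h k i * wave h k i = 2 * h := by
  have e : ∀ i : Fin n, wave h k i * wave h k i =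
      (if (i : ℕ) / h = 2 * k then 1 else 0) + (if (i : ℕ) / h = 2 * k + 1 then 1 else 0) :=
    fun i => by
      rw [wave]
      split_ifs <;> first | omega | norm_num
  simp_rw [e]
  rw [Finset.sum_add_distrib, sum_ite_div_eq _ hh (by nlinarith),
    sum_ite_div_eq _ hh (by nlinarith), two_mul]

theorem haar_neg_one (N k : ℕ) (i : Fin (2 ^ N)) : haar N (-1, k) i = 1 / √((2 : ℝ) ^ N) := by
  simp [haar]

theorem haar_natCast {N j : ℕ} (hj : j < N) (k : ℕ) (i : Fin (2 ^ N)) :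
    haar N ((j : ℤ), k) i =
      (2 : ℝ) ^ ((j : ℝ) / 2) / √((2 : ℝ) ^ N) * wave (2 ^ (N - 1 - j)) k i := by
  have hj' : (j : ℤ) ≠ -1 := by omega
  simp only [haar, if_neg hj', Int.cast_natCast]
  congr 1
  set h := 2 ^ (N - 1 - j) with hh
  have hpos : 0 < h := by positivity
  have hN : (2 : ℝ) ^ N = 2 ^ j * (2 * h) := by
    have : 2 ^ N = 2 ^ j * (2 * h) := by
      rw [hh, ← pow_succ', ← pow_add]
      congr 1
      omega
    exact_mod_cast this
  have hx : (2 : ℝ) ^ (j : ℤ) * (((i : ℕ) + 1 : ℝ) / (2 : ℝ) ^ N) - k =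
      ((i : ℕ) + 1 - 2 * k * h : ℝ) / (2 * h) := by
    rw [hN, zpow_natCast]
    field_simp
  have hR : (0 : ℝ) < 2 * h := by positivity
  rw [hx, mother, wave]
  have c1 : (0 < ((i : ℕ) + 1 - 2 * k * h : ℝ) / (2 * h)) ↔ 2 * k * h ≤ i := by
    rw [lt_div_iff₀ hR, zero_mul, sub_pos, ← Nat.lt_succ_iff]
    exact_mod_cast Iff.rfl
  have c2 : (((i : ℕ) + 1 - 2 * k * h : ℝ) / (2 * h) ≤ 1 / 2) ↔ i < (2 * k + 1) * h := by
    rw [div_le_iff₀ hR, ← Nat.succ_le_iff, ← Nat.cast_le (α := ℝ)]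
    push_cast
    constructor <;> intro H <;> linarith
  have c3 : (((i : ℕ) + 1 - 2 * k * h : ℝ) / (2 * h) ≤ 1) ↔ i < (2 * k + 1 + 1) * h := by
    rw [div_le_iff₀ hR, ← Nat.succ_le_iff, ← Nat.cast_le (α := ℝ)]
    push_cast
    constructor <;> intro H <;> linarith
  have c4 : (1 / 2 < ((i : ℕ) + 1 - 2 * k * h : ℝ) / (2 * h)) ↔ (2 * k + 1) * h ≤ i := by
    rw [← not_le, c2, not_lt]
  have d1 := natDiv_eq_iff hpos i (2 * k)
  have d2 := natDiv_eq_iff hpos i (2 * k + 1)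
  simp only [c1, c2, c3, c4, ← d1, ← d2]
  split_ifs <;> first | omega | norm_num

/-- The indices of the Haar vectors of level less than `N`. This is the full index set `Λ` of the
Haar basis of `ℝ^n` for `n = 2 ^ N`, and every index set in `𝓜_J` contains `coarse J`. -/
def coarse (N : ℕ) : Finset (ℤ × ℕ) := (Finset.Ico (-1 : ℤ) N).biUnion level

theorem mem_level {j : ℤ} {l : ℤ × ℕ} : l ∈ level j ↔ l.1 = j ∧ l.2 < 2 ^ j.toNat := by
  rw [level, Finset.mem_product, Finset.mem_singleton, Finset.mem_range]

theorem mem_coarse {N : ℕ} {l : ℤ × ℕ} :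
    l ∈ coarse N ↔ (-1 ≤ l.1 ∧ l.1 < N) ∧ l.2 < 2 ^ l.1.toNat := by
  simp only [coarse, Finset.mem_biUnion, Finset.mem_Ico, mem_level]
  constructor
  · rintro ⟨j, hj, rfl, h⟩
    exact ⟨hj, h⟩
  · rintro ⟨hj, h⟩
    exact ⟨l.1, hj, rfl, h⟩

theorem coarse_mono {J N : ℕ} (h : J ≤ N) : coarse J ⊆ coarse N := fun l hl => by
  rw [mem_coarse] at hl ⊢
  exact ⟨⟨hl.1.1, by omega⟩, hl.2⟩

theorem card_level (j : ℤ) : (level j).card = 2 ^ j.toNat := by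
  simp [level]

theorem card_coarse (J : ℕ) : (coarse J).card = 2 ^ J := by
  induction J with
  | zero =>
    have : coarse 0 = {((-1 : ℤ), 0)} := by
      ext ⟨j, k⟩
      simp only [mem_coarse, Finset.mem_singleton, Prod.mk.injEq]
      constructor
      · rintro ⟨⟨h1, h2⟩, h3⟩
        obtain rfl : j = -1 := by push_cast at h2; omega
        exact ⟨rfl, by simpa using h3⟩
      · rintro ⟨rfl, rfl⟩
        simp
    rw [this]
    simp
  | succ J ih =>
    have : coarse (J + 1) = coarse J ∪ level J := by
      ext l
      rw [Finset.mem_union, mem_coarse, mem_coarse, mem_level]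
      constructor
      · rintro ⟨⟨h1, h2⟩, h3⟩
        by_cases h : l.1 = J
        · exact Or.inr ⟨h, h ▸ h3⟩
        · exact Or.inl ⟨⟨h1, by push_cast at h2; omega⟩, h3⟩
      · rintro (⟨⟨h1, h2⟩, h3⟩ | ⟨h1, h2⟩)
        · exact ⟨⟨h1, by push_cast; omega⟩, h3⟩
        · exact ⟨⟨by omega, by push_cast; omega⟩, h1 ▸ h2⟩
    rw [this, Finset.card_union_of_disjoint, ih, card_level, Int.toNat_natCast, pow_succ, mul_two]
    rw [Finset.disjoint_left]
    intro l hl hl'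
    rw [mem_coarse] at hl
    rw [mem_level] at hl'
    omega

theorem inner_haar_of_lt {N : ℕ} {l l' : ℤ × ℕ} (hl : l ∈ coarse N) (hl' : l' ∈ coarse N)
    (h : l.1 < l'.1) : inner ℝ (haar N l) (haar N l') = 0 := by
  obtain ⟨j, k⟩ := l
  obtain ⟨j', k'⟩ := l'
  simp only [mem_coarse] at hl hl' h
  obtain ⟨J', rfl⟩ := Int.eq_ofNat_of_zero_le (show 0 ≤ j' by omega)
  have hJ' : J' < N := by omega
  set h' := 2 ^ (N - 1 - J') with hh'
  have hN : 2 ^ J' * (2 * h') = 2 ^ N := by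
    rw [hh', ← pow_succ', ← pow_add]
    congr 1
    omega
  have hk : (k' + 1) * (2 * h') ≤ 2 ^ N := by
    rw [← hN]
    have := hl'.2
    simp only [Int.toNat_natCast] at this
    exact Nat.mul_le_mul_right _ this
  have hpos : 0 < h' := by positivity
  have key : ∃ g : ℕ → ℝ, ∀ i : Fin (2 ^ N), haar N (j, k) i = g ((i : ℕ) / (2 * h')) := by
    by_cases hj : j = -1
    · subst hj
      exact ⟨fun _ => 1 / √((2 : ℝ) ^ N), fun i => haar_neg_one N k i⟩
    · obtain ⟨J, rfl⟩ := Int.eq_ofNat_of_zero_le (show 0 ≤ j by omega)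
      have hJ : J < J' := by omega
      have e : 2 ^ (N - 1 - J) = 2 * h' * 2 ^ (J' - J - 1) := by
        rw [hh', ← pow_succ', ← pow_add]
        congr 1
        omega
      refine ⟨fun x => (2 : ℝ) ^ ((J : ℝ) / 2) / √((2 : ℝ) ^ N) *
        wave (2 ^ (J' - J - 1)) k x, fun i => ?_⟩
      rw [haar_natCast (hJ.trans hJ'), e]
      simp only [wave, Nat.div_div_eq_div_mul]
  obtain ⟨g, hg⟩ := key
  rw [PiLp.inner_apply]
  have e : ∀ i : Fin (2 ^ N), inner ℝ (haar N (j, k) i) (haar N ((J' : ℤ), k') i) =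
      (2 : ℝ) ^ ((J' : ℝ) / 2) / √((2 : ℝ) ^ N) * (g ((i : ℕ) / (2 * h')) * wave h' k' i) :=
    fun i => by
      rw [haar_natCast hJ', hg, ← hh']
      simp only [RCLike.inner_apply, conj_trivial]
      ring
  have e' := Finset.sum_congr rfl fun i (_ : i ∈ Finset.univ) => e i
  refine e'.trans ?_
  rw [← Finset.mul_sum, sum_mul_wave hpos hk, mul_zero]

theorem inner_haar {N : ℕ} {l l' : ℤ × ℕ} (hl : l ∈ coarse N) (hl' : l' ∈ coarse N) :
    inner ℝ (haar N l) (haar N l') = if l = l' then 1 else 0 := by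
  rcases lt_trichotomy l.1 l'.1 with h | h | h
  · rw [inner_haar_of_lt hl hl' h, if_neg fun e => h.ne (congrArg Prod.fst e)]
  · obtain ⟨j, k⟩ := l
    obtain ⟨j', k'⟩ := l'
    obtain rfl : j = j' := h
    simp only [mem_coarse] at hl hl'
    by_cases hj : j = -1
    · subst hj
      have hk : k = 0 := by simpa using hl.2
      have hk' : k' = 0 := by simpa using hl'.2
      subst hk hk'
      rw [if_pos rfl, real_inner_self_eq_norm_sq, EuclideanSpace.real_norm_sq_eq]
      simp [haar_neg_one]
    · obtain ⟨J, rfl⟩ := Int.eq_ofNat_of_zero_le (show 0 ≤ j by omega)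
      have hJ : J < N := by omega
      set h' := 2 ^ (N - 1 - J) with hh'
      have hN : 2 ^ J * (2 * h') = 2 ^ N := by
        rw [hh', ← pow_succ', ← pow_add]
        congr 1
        omega
      have hk : (k + 1) * (2 * h') ≤ 2 ^ N := by
        rw [← hN]
        have := hl.2
        simp only [Int.toNat_natCast] at this
        exact Nat.mul_le_mul_right _ this
      have hpos : 0 < h' := by positivity
      have e : inner ℝ (haar N ((J : ℤ), k)) (haar N ((J : ℤ), k')) =
          (2 : ℝ) ^ J / (2 : ℝ) ^ N * ∑ i : Fin (2 ^ N), wave h' k i * wave h' k' i := by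
        rw [PiLp.inner_apply, Finset.mul_sum]
        refine Finset.sum_congr rfl fun i _ => ?_
        rw [haar_natCast hJ, haar_natCast hJ]
        have e1 : ((2 : ℝ) ^ ((J : ℝ) / 2)) * ((2 : ℝ) ^ ((J : ℝ) / 2)) = 2 ^ J := by
          rw [← Real.rpow_add two_pos, add_halves, Real.rpow_natCast]
        have e2 : √((2 : ℝ) ^ N) * √((2 : ℝ) ^ N) = 2 ^ N := Real.mul_self_sqrt (by positivity)
        rw [← hh', ← e1, ← congrArg (_ / ·) e2, mul_div_mul_comm]
        simp only [RCLike.inner_apply, conj_trivial]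
        ring
      rw [e]
      by_cases hkk : k = k'
      · subst hkk
        rw [sum_wave_sq hpos hk, if_pos rfl]
        have : (2 : ℝ) ^ J * (2 * (h' : ℕ)) = 2 ^ N := by exact_mod_cast hN
        rw [← this]
        have h0 : (0 : ℝ) < h' := by exact_mod_cast hpos
        field_simp
      · rw [if_neg (by simpa using hkk), Finset.sum_eq_zero, mul_zero]
        intro i _
        by_cases hi : (i : ℕ) / (2 * h') = k
        · rw [wave_eq_zero (k := k') fun hi' => hkk (hi.symm.trans hi'), mul_zero]
        · rw [wave_eq_zero hi, zero_mul]
  · rw [real_inner_comm, inner_haar_of_lt hl' hl h, if_neg fun e => h.ne' (congrArg Prod.fst e)]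

theorem orthonormal_haar {N : ℕ} {m : Finset (ℤ × ℕ)} (hm : m ⊆ coarse N) :
    Orthonormal ℝ fun l : m => haar N l := by
  rw [orthonormal_iff_ite]
  intro l l'
  rw [inner_haar (hm l.2) (hm l'.2)]
  simp only [Subtype.ext_iff]

/-- The Haar vectors with index in `Λ` form a basis of `ℝ^n`, since there are `n` of them. -/
theorem sum_inner_smul_haar {N : ℕ} (x : EuclideanSpace ℝ (Fin (2 ^ N))) :
    ∑ l ∈ coarse N, inner ℝ (haar N l) x • haar N l = x := by
  have ho := orthonormal_haar (Finset.Subset.refl (coarse N))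
  have hspan := ho.linearIndependent.span_eq_top_of_card_eq_finrank' (by
    rw [Fintype.card_coe, card_coarse, finrank_euclideanSpace_fin])
  let b := OrthonormalBasis.mk ho hspan.ge
  have h := b.sum_repr' x
  rw [← Finset.sum_coe_sort]
  refine Eq.trans (Finset.sum_congr rfl fun l _ => ?_) h
  rw [OrthonormalBasis.coe_mk]

theorem norm_sq_sum_smul_haar {N : ℕ} {m : Finset (ℤ × ℕ)} (hm : m ⊆ coarse N)
    (a : ℤ × ℕ → ℝ) : ‖∑ l ∈ m, a l • haar N l‖ ^ 2 = ∑ l ∈ m, a l ^ 2 := by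
  rw [← real_inner_self_eq_norm_sq, sum_inner]
  refine Finset.sum_congr rfl fun l hl => ?_
  rw [inner_sum, Finset.sum_eq_single l]
  · rw [real_inner_smul_left, real_inner_smul_right, inner_haar (hm hl) (hm hl), if_pos rfl]
    ring
  · intro l' hl' hne
    rw [real_inner_smul_left, real_inner_smul_right, inner_haar (hm hl) (hm hl'), if_neg hne.symm]
    ring
  · exact fun h => absurd hl h

theorem norm_sub_starProjection_model_sq_le {N : ℕ} {m : Finset (ℤ × ℕ)} (hm : m ⊆ coarse N)
    (x : EuclideanSpace ℝ (Fin (2 ^ N))) :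
    ‖x - (model N m).starProjection x‖ ^ 2 ≤
      ∑ l ∈ coarse N \ m, inner ℝ (haar N l) x ^ 2 := by
  set y := ∑ l ∈ m, inner ℝ (haar N l) x • haar N l with hy
  have hym : y ∈ model N m := Submodule.sum_mem _ fun l hl =>
    Submodule.smul_mem _ _ (Submodule.subset_span ⟨l, hl, rfl⟩)
  have hxy : x - y = ∑ l ∈ coarse N \ m, inner ℝ (haar N l) x • haar N l := by
    rw [sub_eq_iff_eq_add, hy, Finset.sum_sdiff hm, sum_inner_smul_haar]
  rw [← norm_sq_sum_smul_haar Finset.sdiff_subset, ← hxy]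
  have e : x - (model N m).starProjection x = (model N m)ᗮ.starProjection (x - y) := by
    rw [Submodule.starProjection_orthogonal_val, map_sub,
      Submodule.starProjection_eq_self_iff.2 hym]
    abel
  rw [e]
  gcongr
  exact Submodule.norm_starProjection_apply_le _ _

theorem norm_sub_leastSquares_sq_le {r N : ℕ} {m : Finset (ℤ × ℕ)} (hm : m ⊆ coarse N)
    (s : Mat r (2 ^ N)) :
    ‖s - leastSquares m s‖ ^ 2 ≤ ∑ l ∈ coarse N \ m, ‖coeff s l‖ ^ 2 := by
  simp_rw [EuclideanSpace.real_norm_sq_eq (coeff s _)]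
  rw [Finset.sum_comm, norm_sq_eq_sum_row]
  refine Finset.sum_le_sum fun j _ => ?_
  have e : row (s - leastSquares m s) j = row s j - (model N m).starProjection (row s j) := by
    rw [← row_starProjection_tensor]
    rfl
  rw [e]
  refine (norm_sub_starProjection_model_sq_le hm _).trans (le_of_eq ?_)
  refine Finset.sum_congr rfl fun l _ => ?_
  rw [real_inner_comm]
  rfl

theorem finrank_model_le_card (N : ℕ) (m : Finset (ℤ × ℕ)) :
    Module.finrank ℝ (model N m) ≤ m.card := by
  classical
  have := finrank_span_finset_le_card (R := ℝ) (m.image (haar N))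
  rw [Finset.coe_image] at this
  exact this.trans Finset.card_image_le

theorem card_le_finrank_model {N : ℕ} {m₀ m : Finset (ℤ × ℕ)} (h₀ : m₀ ⊆ coarse N) (h : m₀ ⊆ m) :
    m₀.card ≤ Module.finrank ℝ (model N m) := by
  have h1 := finrank_span_eq_card (orthonormal_haar h₀).linearIndependent
  rw [Fintype.card_coe] at h1
  rw [← h1]
  refine Submodule.finrank_mono (Submodule.span_mono ?_)
  rintro _ ⟨l, rfl⟩
  exact ⟨l, h l.2, rfl⟩

theorem model_union (N : ℕ) (m m' : Finset (ℤ × ℕ)) :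
    model N (m ∪ m') = model N m ⊔ model N m' := by
  rw [model, Finset.coe_union, Set.image_union, Submodule.span_union]
  rfl

theorem finrank_model_union_le (N : ℕ) (m m' : Finset (ℤ × ℕ)) :
    Module.finrank ℝ (model N (m ∪ m')) ≤
      Module.finrank ℝ (model N m) + Module.finrank ℝ (model N m') := by
  rw [model_union]
  exact Submodule.finrank_add_le_finrank_add_finrank _ _

/-! ### Counting the models -/

theorem sum_one_div_succ_sq_le (K : ℕ) :
    ∑ k ∈ Finset.range K, 1 / ((k : ℝ) + 1) ^ 2 ≤ 2 := by
  suffices h : ∑ k ∈ Finset.range K, 1 / ((k : ℝ) + 1) ^ 2 ≤ 2 - 1 / (K : ℝ) by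
    have : (0 : ℝ) ≤ 1 / K := by positivity
    linarith
  induction K with
  | zero => simp
  | succ K ih =>
    rw [Finset.sum_range_succ]
    rcases Nat.eq_zero_or_pos K with rfl | hK
    · norm_num
    · have hK' : (0 : ℝ) < K := by exact_mod_cast hK
      have : 1 / ((K : ℝ) + 1) ^ 2 ≤ 1 / K - 1 / (K + 1) := by
        rw [div_sub_div _ _ hK'.ne' (by positivity), div_le_div_iff₀ (by positivity) (by positivity)]
        nlinarith
      push_cast
      linarith

theorem natCast_two_pow_div_le (J k : ℕ) :
    ((2 ^ J / (k + 1) ^ 3 : ℕ) : ℝ) ≤ 2 ^ J / ((k : ℝ) + 1) ^ 3 := by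
  have := Nat.cast_div_le (α := ℝ) (m := 2 ^ J) (n := (k + 1) ^ 3)
  simpa using this

/-- Binomial coefficients are bounded by keeping one term of `(1 + t) ^ n`, with `t = exp (-x)`. -/
theorem choose_le_exp_mul_exp (n d : ℕ) (x : ℝ) :
    (n.choose d : ℝ) ≤ Real.exp (n * Real.exp (-x)) * Real.exp (d * x) := by
  set t := Real.exp (-x) with ht
  have ht0 : 0 < t := Real.exp_pos _
  have h1 : (n.choose d : ℝ) * t ^ d ≤ (t + 1) ^ n := by
    rcases le_or_gt d n with hd | hd
    · rw [add_pow]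
      have h := Finset.single_le_sum (f := fun m => t ^ m * 1 ^ (n - m) * (n.choose m : ℝ))
        (fun m _ => by positivity) (Finset.mem_range.2 (Nat.lt_succ_of_le hd))
      refine le_trans (le_of_eq ?_) h
      simp only [one_pow, mul_one]
      ring
    · rw [Nat.choose_eq_zero_of_lt hd]
      simp only [Nat.cast_zero, zero_mul]
      positivity
  have h2 : (t + 1) ^ n ≤ Real.exp (n * t) := by
    rw [Real.exp_nat_mul]
    exact pow_le_pow_left₀ (by positivity) (Real.add_one_le_exp t) n
  have h3 : t ^ d * Real.exp (d * x) = 1 := by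
    rw [ht, ← Real.exp_nat_mul, ← Real.exp_add]
    simp
  calc (n.choose d : ℝ) = n.choose d * t ^ d * Real.exp (d * x) := by rw [mul_assoc, h3, mul_one]
    _ ≤ _ := mul_le_mul_of_nonneg_right (h1.trans h2) (Real.exp_pos _).le

theorem choose_level_le (J k : ℕ) :
    (((2 ^ (J + k)).choose (2 ^ J / (k + 1) ^ 3) : ℕ) : ℝ) ≤
      Real.exp (4 * 2 ^ J * (1 / ((k : ℝ) + 1) ^ 2)) := by
  -- With `x = 4 * k` both factors are controlled, because `2 ^ k * (k + 1) ^ 3 ≤ exp (4 * k)`.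
  refine (choose_le_exp_mul_exp _ _ (4 * k)).trans ?_
  rw [← Real.exp_add]
  refine Real.exp_le_exp.2 ?_
  have hk1 : (0 : ℝ) < (k : ℝ) + 1 := by positivity
  have h1 : (2 : ℝ) ^ k * Real.exp (-(4 * k)) ≤ 1 / ((k : ℝ) + 1) ^ 3 := by
    have e1 : (2 : ℝ) ^ k ≤ Real.exp k := by
      rw [← Real.exp_one_pow]
      exact pow_le_pow_left₀ (by norm_num) (by linarith [Real.add_one_le_exp 1]) k
    have e2 : ((k : ℝ) + 1) ^ 3 ≤ Real.exp (3 * k) := by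
      have := pow_le_pow_left₀ hk1.le (Real.add_one_le_exp (k : ℝ)) 3
      rw [← Real.exp_nat_mul] at this
      exact_mod_cast this
    rw [le_div_iff₀ (by positivity)]
    calc _ ≤ Real.exp k * Real.exp (-(4 * k)) * Real.exp (3 * k) := by gcongr
      _ = 1 := by
        rw [← Real.exp_add, ← Real.exp_add, ← Real.exp_zero]
        congr 1
        ring
  have h2 := natCast_two_pow_div_le J k
  have hJ : (0 : ℝ) < 2 ^ J := by positivity
  calc ((2 ^ (J + k) : ℕ) : ℝ) * Real.exp (-(4 * k)) + ((2 ^ J / (k + 1) ^ 3 : ℕ) : ℝ) * (4 * k)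
      = 2 ^ J * (2 ^ k * Real.exp (-(4 * k))) + ((2 ^ J / (k + 1) ^ 3 : ℕ) : ℝ) * (4 * k) := by
        push_cast
        ring
    _ ≤ 2 ^ J * (1 / ((k : ℝ) + 1) ^ 3) + 2 ^ J / ((k : ℝ) + 1) ^ 3 * (4 * k) := by gcongr
    _ ≤ 4 * 2 ^ J * (1 / ((k : ℝ) + 1) ^ 2) := by
        have e : 4 * 2 ^ J * (1 / ((k : ℝ) + 1) ^ 2) -
            (2 ^ J * (1 / ((k : ℝ) + 1) ^ 3) + 2 ^ J / ((k : ℝ) + 1) ^ 3 * (4 * k)) =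
            3 * 2 ^ J / ((k : ℝ) + 1) ^ 3 := by
          field_simp
          ring
        have : (0 : ℝ) ≤ 3 * 2 ^ J / ((k : ℝ) + 1) ^ 3 := by positivity
        linarith

/-- The collection `𝓜_J` as a finite set. -/
def modelsAt (N J : ℕ) : Finset (Finset (ℤ × ℕ)) :=
  (Fintype.piFinset fun k : Fin (N - J) =>
    (level ((J : ℤ) + (k : ℕ))).powersetCard (2 ^ J / ((k : ℕ) + 1) ^ 3)).image
      fun L => coarse J ∪ Finset.univ.biUnion L

theorem mem_modelsAt {N J : ℕ} {m : Finset (ℤ × ℕ)} (hm : m ∈ collectionAt N J) :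
    m ∈ modelsAt N J := by
  obtain ⟨L, hL, rfl⟩ := hm
  rw [modelsAt, Finset.mem_image]
  refine ⟨fun k => L k, ?_, ?_⟩
  · rw [Fintype.mem_piFinset]
    exact fun k => Finset.mem_powersetCard.2 (hL k k.2)
  · rw [coarse]
    congr 1
    ext l
    simp only [Finset.mem_biUnion, Finset.mem_univ, true_and, Finset.mem_range]
    exact ⟨fun ⟨k, hk⟩ => ⟨k, k.2, hk⟩, fun ⟨k, hk, hl⟩ => ⟨⟨k, hk⟩, hl⟩⟩

theorem coarse_subset_of_mem_modelsAt {N J : ℕ} {m : Finset (ℤ × ℕ)} (hm : m ∈ modelsAt N J) :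
    coarse J ⊆ m := by
  obtain ⟨L, _, rfl⟩ := Finset.mem_image.1 hm
  exact Finset.subset_union_left

theorem level_subset_coarse {N j : ℕ} (hj : j < N) : level (j : ℤ) ⊆ coarse N := fun l hl => by
  rw [mem_level] at hl
  rw [mem_coarse, hl.1]
  exact ⟨⟨by omega, by omega⟩, hl.2⟩

theorem subset_coarse_of_mem_modelsAt {N J : ℕ} (hJ : J < N) {m : Finset (ℤ × ℕ)}
    (hm : m ∈ modelsAt N J) : m ⊆ coarse N := by
  obtain ⟨L, hL, rfl⟩ := Finset.mem_image.1 hm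
  rw [Fintype.mem_piFinset] at hL
  refine Finset.union_subset (coarse_mono hJ.le) (Finset.biUnion_subset.2 fun k _ => ?_)
  refine (Finset.mem_powersetCard.1 (hL k)).1.trans ?_
  have := level_subset_coarse (N := N) (j := J + k) (by omega)
  exact_mod_cast this

theorem card_le_of_mem_modelsAt {N J : ℕ} {m : Finset (ℤ × ℕ)} (hm : m ∈ modelsAt N J) :
    (m.card : ℝ) ≤ 3 * 2 ^ J := by
  obtain ⟨L, hL, rfl⟩ := Finset.mem_image.1 hm
  rw [Fintype.mem_piFinset] at hL
  have h1 : (coarse J ∪ Finset.univ.biUnion L).card ≤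
      2 ^ J + ∑ k ∈ Finset.range (N - J), 2 ^ J / (k + 1) ^ 3 := by
    refine (Finset.card_union_le _ _).trans ?_
    rw [card_coarse, ← Fin.sum_univ_eq_sum_range fun k => 2 ^ J / (k + 1) ^ 3]
    refine add_le_add_right (Finset.card_biUnion_le.trans (le_of_eq ?_)) _
    exact Finset.sum_congr rfl fun k _ => (Finset.mem_powersetCard.1 (hL k)).2
  have h2 : ∑ k ∈ Finset.range (N - J), ((2 ^ J / (k + 1) ^ 3 : ℕ) : ℝ) ≤
      ∑ k ∈ Finset.range (N - J), 2 ^ J * (1 / ((k : ℝ) + 1) ^ 2) := by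
    refine Finset.sum_le_sum fun k _ => (natCast_two_pow_div_le J k).trans ?_
    rw [mul_one_div]
    have hk : (1 : ℝ) ≤ (k : ℝ) + 1 := by linarith [Nat.cast_nonneg (α := ℝ) k]
    exact div_le_div_of_nonneg_left (by positivity) (by positivity)
      (pow_le_pow_right₀ hk (by norm_num))
  rw [← Finset.mul_sum] at h2
  have h3 := mul_le_mul_of_nonneg_left (sum_one_div_succ_sq_le (N - J))
    (show (0 : ℝ) ≤ 2 ^ J by positivity)
  have h4 : ((coarse J ∪ Finset.univ.biUnion L).card : ℝ) ≤
      2 ^ J + ∑ k ∈ Finset.range (N - J), ((2 ^ J / (k + 1) ^ 3 : ℕ) : ℝ) := by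
    exact_mod_cast h1
  linarith

theorem card_modelsAt_le (N J : ℕ) : ((modelsAt N J).card : ℝ) ≤ Real.exp (8 * 2 ^ J) := by
  have h1 : (modelsAt N J).card ≤ ∏ k ∈ Finset.range (N - J),
      (2 ^ (J + k)).choose (2 ^ J / (k + 1) ^ 3) := by
    refine Finset.card_image_le.trans (le_of_eq ?_)
    rw [Fintype.card_piFinset, Finset.prod_range]
    refine Finset.prod_congr rfl fun k _ => ?_
    rw [Finset.card_powersetCard, card_level]
    rfl
  calc ((modelsAt N J).card : ℝ) ≤ ∏ k ∈ Finset.range (N - J),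
        (((2 ^ (J + k)).choose (2 ^ J / (k + 1) ^ 3) : ℕ) : ℝ) := by exact_mod_cast h1
    _ ≤ ∏ k ∈ Finset.range (N - J), Real.exp (4 * 2 ^ J * (1 / ((k : ℝ) + 1) ^ 2)) :=
        Finset.prod_le_prod (fun _ _ => Nat.cast_nonneg _) fun k _ => choose_level_le J k
    _ = Real.exp (4 * 2 ^ J * ∑ k ∈ Finset.range (N - J), 1 / ((k : ℝ) + 1) ^ 2) := by
        rw [← Real.exp_sum, Finset.mul_sum]
    _ ≤ Real.exp (8 * 2 ^ J) := by
        refine Real.exp_le_exp.2 ?_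
        have := mul_le_mul_of_nonneg_left (sum_one_div_succ_sq_le (N - J))
          (show (0 : ℝ) ≤ 4 * 2 ^ J by positivity)
        linarith

theorem two_pow_le_finrank_model {N J : ℕ} (hJ : J < N) {m : Finset (ℤ × ℕ)}
    (hm : m ∈ modelsAt N J) : (2 : ℝ) ^ J ≤ Module.finrank ℝ (model N m) := by
  have := card_le_finrank_model (coarse_mono hJ.le) (coarse_subset_of_mem_modelsAt hm)
  rw [card_coarse] at this
  exact_mod_cast this

/-- The weights `exp (-9 * D_m)` of the union bound over all models are summable, uniformly in `N`. -/
theorem sum_models_exp_le (N : ℕ) :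
    ∑ J ∈ Finset.range N, ∑ m ∈ modelsAt N J,
      Real.exp (-(9 * (Module.finrank ℝ (model N m) : ℝ))) ≤ 2 := by
  refine le_trans (Finset.sum_le_sum fun J hJ => ?_) (sum_geometric_two_le N)
  have h1 : ∀ m ∈ modelsAt N J, Real.exp (-(9 * (Module.finrank ℝ (model N m) : ℝ))) ≤
      Real.exp (-(9 * 2 ^ J)) := fun m hm => by
    refine Real.exp_le_exp.2 ?_
    linarith [two_pow_le_finrank_model (Finset.mem_range.1 hJ) hm]
  refine (Finset.sum_le_sum h1).trans ?_
  rw [Finset.sum_const, nsmul_eq_mul]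
  calc ((modelsAt N J).card : ℝ) * Real.exp (-(9 * 2 ^ J))
      ≤ Real.exp (8 * 2 ^ J) * Real.exp (-(9 * 2 ^ J)) := by
        gcongr
        exact card_modelsAt_le N J
    _ = (Real.exp (2 ^ J))⁻¹ := by
        rw [← Real.exp_add, ← Real.exp_neg]
        congr 1
        ring
    _ ≤ (1 / 2) ^ J := by
        rw [one_div, inv_pow]
        gcongr
        linarith [Real.add_one_le_exp ((2 : ℝ) ^ J)]

/-! ### Approximation over the Besov body -/

theorem exists_subset_card_eq_forall_le {ι : Type*} [DecidableEq ι] (s : Finset ι) (a : ι → ℝ)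
    {d : ℕ} (hd : d ≤ s.card) :
    ∃ L ⊆ s, L.card = d ∧ ∀ x ∈ L, ∀ y ∈ s \ L, a y ≤ a x := by
  induction d with
  | zero => exact ⟨∅, by simp⟩
  | succ d ih =>
    obtain ⟨L, hLs, hLd, hL⟩ := ih (Nat.le_of_succ_le hd)
    have hne : (s \ L).Nonempty := by
      rw [← Finset.card_pos, Finset.card_sdiff_of_subset hLs]
      omega
    obtain ⟨z, hz, hmax⟩ := Finset.exists_max_image (s \ L) a hne
    rw [Finset.mem_sdiff] at hz
    refine ⟨insert z L, Finset.insert_subset hz.1 hLs, ?_, ?_⟩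
    · rw [Finset.card_insert_of_notMem hz.2, hLd]
    · intro x hx y hy
      have hy' : y ∈ s \ L :=
        Finset.sdiff_subset_sdiff (Finset.Subset.refl s) (Finset.subset_insert z L) hy
      rcases Finset.mem_insert.1 hx with rfl | hx
      · exact hmax y hy'
      · exact hL x hx y hy'

/-- The `d` largest of the nonnegative numbers `a i` leave out a small sum of squares, when
`∑ a i ^ p ≤ B`: each of the others satisfies `(d + 1) * a i ^ p ≤ B`. The bound equals
`B ^ (2 / p) * D ^ (1 - 2 / p)`, where `D` stands for `d + 1` or any smaller positive number. -/
theorem exists_subset_sum_sq_sdiff_le {ι : Type*} [DecidableEq ι] (s : Finset ι) (a : ι → ℝ)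
    (ha : ∀ i, 0 ≤ a i) {p : ℝ} (hp : 0 < p) (hp2 : p ≤ 2) {d : ℕ} (hd : d ≤ s.card)
    {B D : ℝ} (hB : ∑ i ∈ s, a i ^ p ≤ B) (hD : 0 < D) (hDd : D ≤ d + 1) :
    ∃ L ⊆ s, L.card = d ∧ ∑ i ∈ s \ L, a i ^ 2 ≤ B * (B / D) ^ (2 / p - 1) := by
  obtain ⟨L, hLs, hLd, hL⟩ := exists_subset_card_eq_forall_le s a hd
  refine ⟨L, hLs, hLd, ?_⟩
  have hq : 0 ≤ 2 / p - 1 := by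
    rw [sub_nonneg, one_le_div hp]
    exact hp2
  have hap : ∀ i, 0 ≤ a i ^ p := fun i => Real.rpow_nonneg (ha i) p
  have hB0 : 0 ≤ B := (Finset.sum_nonneg fun i _ => hap i).trans hB
  have h1 : ∀ y ∈ s \ L, a y ^ p ≤ B / D := fun y hy => by
    have hy' := Finset.mem_sdiff.1 hy
    have h2 : ((d : ℝ) + 1) * a y ^ p ≤ ∑ i ∈ insert y L, a i ^ p := by
      have h3 := Finset.card_nsmul_le_sum (insert y L) (fun i => a i ^ p) (a y ^ p) fun x hx => by
        rcases Finset.mem_insert.1 hx with rfl | hx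
        · exact le_rfl
        · exact Real.rpow_le_rpow (ha y) (hL x hx y hy) hp.le
      rw [Finset.card_insert_of_notMem hy'.2, hLd, nsmul_eq_mul] at h3
      exact_mod_cast h3
    have h3 : ∑ i ∈ insert y L, a i ^ p ≤ ∑ i ∈ s, a i ^ p :=
      Finset.sum_le_sum_of_subset_of_nonneg (Finset.insert_subset hy'.1 hLs) fun i _ _ => hap i
    rw [le_div_iff₀ hD, mul_comm]
    exact (mul_le_mul_of_nonneg_right hDd (hap y)).trans (h2.trans (h3.trans hB))
  have h2 : ∀ y ∈ s \ L, a y ^ 2 ≤ a y ^ p * (B / D) ^ (2 / p - 1) := fun y hy => by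
    have e : a y ^ 2 = a y ^ p * (a y ^ p) ^ (2 / p - 1) := by
      rw [← Real.rpow_mul (ha y), ← Real.rpow_add' (ha y)]
      · rw [← Real.rpow_natCast]
        congr 1
        field_simp
        norm_num
      · field_simp
        norm_num
    rw [e]
    exact mul_le_mul_of_nonneg_left (Real.rpow_le_rpow (hap y) (h1 y hy) hq) (hap y)
  refine (Finset.sum_le_sum h2).trans ?_
  rw [← Finset.sum_mul]
  refine mul_le_mul_of_nonneg_right (le_trans ?_ hB) (Real.rpow_nonneg (by positivity) _)
  exact Finset.sum_le_sum_of_subset_of_nonneg Finset.sdiff_subset fun i _ _ => hap i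

theorem summable_two_rpow_neg_mul_rpow {δ : ℝ} (hδ : 0 < δ) (q : ℝ) :
    Summable fun k : ℕ => (2 : ℝ) ^ (-(2 * δ * k)) * ((k : ℝ) + 1) ^ q := by
  set ρ : ℝ := 2 ^ (-(2 * δ)) with hρ
  have hρ0 : 0 < ρ := Real.rpow_pos_of_pos two_pos _
  have hρ1 : ρ < 1 := Real.rpow_lt_one_of_one_lt_of_neg one_lt_two (by linarith)
  have h := summable_pow_mul_geometric_of_norm_lt_one ⌈q⌉₊ (r := ρ) (by
    rwa [Real.norm_of_nonneg hρ0.le])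
  have h' := ((summable_nat_add_iff 1).2 h).mul_left ρ⁻¹
  refine Summable.of_nonneg_of_le (fun k => by positivity) (fun k => ?_) h'
  have hk : (1 : ℝ) ≤ (k : ℝ) + 1 := by linarith [Nat.cast_nonneg (α := ℝ) k]
  have e1 : (2 : ℝ) ^ (-(2 * δ * k)) = ρ ^ k := by
    rw [hρ, ← Real.rpow_natCast, ← Real.rpow_mul two_pos.le]
    congr 1
    ring
  have e2 : ((k : ℝ) + 1) ^ q ≤ ((k : ℝ) + 1) ^ ⌈q⌉₊ := by
    rw [← Real.rpow_natCast]
    exact Real.rpow_le_rpow_of_exponent_le hk (Nat.le_ceil q)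
  rw [e1]
  calc ρ ^ k * ((k : ℝ) + 1) ^ q ≤ ρ ^ k * ((k : ℝ) + 1) ^ ⌈q⌉₊ := by gcongr
    _ = ρ⁻¹ * (((k + 1 : ℕ) : ℝ) ^ ⌈q⌉₊ * ρ ^ (k + 1)) := by
        push_cast
        field_simp
        rw [pow_succ]

/-- The constant in the bound on the approximation error over the Besov body. -/
def besovConst (α p : ℝ) : ℝ :=
  ∑' k : ℕ, (2 : ℝ) ^ (-(2 * (α + 1 / 2 - 1 / p) * k)) * ((k : ℝ) + 1) ^ (3 * (2 / p - 1))

theorem besovConst_nonneg (α p : ℝ) : 0 ≤ besovConst α p :=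
  tsum_nonneg fun _ => by positivity

theorem sum_level_rpow_le {r N : ℕ} {R α p : ℝ} {s : Mat r (2 ^ N)} (hs : s ∈ besovBody r N R α p)
    {j : ℕ} (hj : j < N) :
    ∑ l ∈ level (j : ℤ), ‖coeff s l‖ ^ p ≤
      ((2 : ℝ) ^ N) ^ (p / 2) * R ^ p * (2 : ℝ) ^ (-((j : ℝ) * p * (α + 1 / 2 - 1 / p))) := by
  have h0 : ∀ j : ℕ, 0 ≤ ∑ l ∈ level (j : ℤ), ‖coeff s l‖ ^ p := fun j =>
    Finset.sum_nonneg fun l _ => Real.rpow_nonneg (norm_nonneg _) _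
  have h := (Finset.single_le_sum (f := fun j : ℕ => (2 : ℝ) ^ ((j : ℝ) * p * (α + 1 / 2 - 1 / p)) *
    ∑ l ∈ level (j : ℤ), ‖coeff s l‖ ^ p) (fun j _ => mul_nonneg (by positivity) (h0 j))
    (Finset.mem_range.2 hj)).trans hs
  rw [Real.rpow_neg two_pos.le, ← div_eq_mul_inv, le_div_iff₀ (by positivity), mul_comm]
  exact h

/-- Some model of `𝓜_J` has a squared bias of order `n R² 2 ^ (-2 α J)` over the Besov body. -/
theorem exists_mem_collectionAt_sum_le {r N J : ℕ} {R α p : ℝ} {s : Mat r (2 ^ N)} (hR : 0 < R)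
    (hp : 0 < p) (hp2 : p ≤ 2) (hα : 1 / p - 1 / 2 < α) (hs : s ∈ besovBody r N R α p) :
    ∃ m ∈ collectionAt N J, ∑ l ∈ coarse N \ m, ‖coeff s l‖ ^ 2 ≤
      besovConst α p * ((2 : ℝ) ^ N * R ^ 2) * (2 : ℝ) ^ (-(2 * α * J)) := by
  set δ := α + 1 / 2 - 1 / p with hδ
  have hδ0 : 0 < δ := by linarith
  have hlev : ∀ k : ℕ, ∃ L : Finset (ℤ × ℕ), k < N - J → (L ⊆ level ((J : ℤ) + k) ∧
      L.card = 2 ^ J / (k + 1) ^ 3 ∧ ∑ l ∈ level ((J : ℤ) + k) \ L, ‖coeff s l‖ ^ 2 ≤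
      ((2 : ℝ) ^ N * R ^ 2) * (2 : ℝ) ^ (-(2 * α * J)) *
        ((2 : ℝ) ^ (-(2 * δ * k)) * ((k : ℝ) + 1) ^ (3 * (2 / p - 1)))) := fun k => by
    by_cases hk : k < N - J
    swap
    · exact ⟨∅, fun h => absurd h hk⟩
    have hB := sum_level_rpow_le hs (j := J + k) (by omega)
    have hcard : 2 ^ J / (k + 1) ^ 3 ≤ (level ((J + k : ℕ) : ℤ)).card := by
      rw [card_level, Int.toNat_natCast]
      exact (Nat.div_le_self _ _).trans (Nat.pow_le_pow_right two_pos (by omega))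
    have hDd : (2 : ℝ) ^ J / ((k : ℝ) + 1) ^ 3 ≤ ((2 ^ J / (k + 1) ^ 3 : ℕ) : ℝ) + 1 := by
      have h1 := Nat.lt_div_mul_add (a := 2 ^ J) (b := (k + 1) ^ 3) (by positivity)
      have h2 : (2 : ℝ) ^ J < ((2 ^ J / (k + 1) ^ 3 : ℕ) : ℝ) * ((k : ℝ) + 1) ^ 3 +
          ((k : ℝ) + 1) ^ 3 := by exact_mod_cast h1
      rw [div_le_iff₀ (by positivity)]
      linarith
    obtain ⟨L, hL1, hL2, hL3⟩ := exists_subset_sum_sq_sdiff_le (level ((J + k : ℕ) : ℤ))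
      (fun l => ‖coeff s l‖) (fun l => norm_nonneg _) hp hp2 hcard hB (by positivity) hDd
    rw [Nat.cast_add] at hL1 hL3
    refine ⟨L, fun _ => ⟨hL1, hL2, hL3.trans (le_of_eq ?_)⟩⟩
    have hk1 : (0 : ℝ) < (k : ℝ) + 1 := by positivity
    set q := 2 / p - 1 with hq
    have hB0 : (0 : ℝ) < ((2 : ℝ) ^ N) ^ (p / 2) * R ^ p *
        (2 : ℝ) ^ (-(((J + k : ℕ) : ℝ) * p * δ)) := by positivity
    have hq2 : 1 + q = 2 / p := by rw [hq]; ring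
    rw [Real.div_rpow hB0.le (by positivity), mul_div_assoc', ← Real.rpow_one_add' hB0.le
      (by rw [hq2]; positivity), hq2, Real.mul_rpow (by positivity) (by positivity),
      Real.mul_rpow (by positivity) (by positivity), ← Real.rpow_mul (by positivity),
      ← Real.rpow_mul hR.le, ← Real.rpow_mul two_pos.le, Real.div_rpow (by positivity)
      (by positivity)]
    have e1 : p / 2 * (2 / p) = 1 := by field_simp
    have e2 : p * (2 / p) = 2 := by field_simp
    have e3 : -(((J + k : ℕ) : ℝ) * p * δ) * (2 / p) = -(2 * α * J) + (-(2 * δ * k)) + J * q := by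
      rw [hq, hδ]
      push_cast
      field_simp
      ring
    have e4 : ((2 : ℝ) ^ J) ^ q = 2 ^ ((J : ℝ) * q) := by
      rw [Real.rpow_mul two_pos.le, Real.rpow_natCast]
    have e5 : (((k : ℝ) + 1) ^ 3) ^ q = ((k : ℝ) + 1) ^ (3 * q) := by
      rw [Real.rpow_mul hk1.le]
      norm_cast
    rw [e1, e2, e3, Real.rpow_one, Real.rpow_two, Real.rpow_add two_pos, Real.rpow_add two_pos,
      e4, e5]
    have : (0 : ℝ) < 2 ^ ((J : ℝ) * q) := by positivity
    field_simp
  choose L hL using hlev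
  refine ⟨_, ⟨L, fun k hk => ⟨(hL k hk).1, (hL k hk).2.1⟩, rfl⟩, ?_⟩
  have hsub : coarse N \ ((Finset.Ico (-1 : ℤ) J).biUnion level ∪ (Finset.range (N - J)).biUnion L) ⊆
      (Finset.range (N - J)).biUnion fun k => level ((J : ℤ) + k) \ L k := by
    intro l hl
    rw [Finset.mem_sdiff, Finset.mem_union, not_or] at hl
    obtain ⟨h1, h2, h3⟩ := hl
    have h2' : l ∉ coarse J := h2
    rw [mem_coarse] at h1 h2'
    have hJ : (J : ℤ) ≤ l.1 := by
      by_contra hlt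
      exact h2' ⟨⟨h1.1.1, by omega⟩, h1.2⟩
    obtain ⟨k, hk⟩ := Int.le.dest hJ
    have hkN : k ∈ Finset.range (N - J) := by
      rw [Finset.mem_range]
      omega
    refine Finset.mem_biUnion.2 ⟨k, hkN, Finset.mem_sdiff.2 ⟨mem_level.2 ⟨hk.symm, ?_⟩, fun h => ?_⟩⟩
    · rw [hk]
      exact h1.2
    · exact h3 (Finset.mem_biUnion.2 ⟨k, hkN, h⟩)
  refine (Finset.sum_le_sum_of_subset_of_nonneg hsub fun l _ _ => sq_nonneg _).trans ?_
  rw [Finset.sum_biUnion]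
  swap
  · intro k _ k' _ hkk
    rw [Function.onFun, Finset.disjoint_left]
    intro l hl hl'
    have h1 := (mem_level.1 (Finset.mem_sdiff.1 hl).1).1
    have h2 := (mem_level.1 (Finset.mem_sdiff.1 hl').1).1
    omega
  refine (Finset.sum_le_sum fun k hk => (hL k (Finset.mem_range.1 hk)).2.2).trans ?_
  rw [← Finset.mul_sum, mul_assoc (besovConst α p), mul_comm (besovConst α p)]
  refine mul_le_mul_of_nonneg_left ?_ (by positivity)
  exact (summable_two_rpow_neg_mul_rpow hδ0 (3 * (2 / p - 1))).sum_le_tsum _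
    fun k _ => by positivity

/-- The level `J` with `2 ^ J ≤ (n R²) ^ (1 / (2 α + 1)) < 2 ^ (J + 1)` balances the squared bias and
the dimension. -/
theorem exists_mem_collection_bias_le {r N : ℕ} {R α p : ℝ} {s : Mat r (2 ^ N)} (hR : 0 < R)
    (hp : 0 < p) (hp2 : p ≤ 2) (hα : 1 / p - 1 / 2 < α) (hRN : R < ((2 : ℝ) ^ N) ^ α)
    (hNR : 1 ≤ (2 : ℝ) ^ N * R ^ 2) (hs : s ∈ besovBody r N R α p) :
    ∃ m ∈ collection N,
      ‖s - leastSquares m s‖ ^ 2 ≤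
        besovConst α p * 2 ^ (2 * α) * ((2 : ℝ) ^ N * R ^ 2) ^ (1 / (2 * α + 1)) ∧
      (Module.finrank ℝ (model N m) : ℝ) ≤ 3 * ((2 : ℝ) ^ N * R ^ 2) ^ (1 / (2 * α + 1)) := by
  have hα0 : 0 < α := by
    have : 1 / 2 ≤ 1 / p := one_div_le_one_div_of_le hp hp2
    linarith
  set A := ((2 : ℝ) ^ N * R ^ 2) ^ (1 / (2 * α + 1)) with hA
  have hA1 : 1 ≤ A := Real.one_le_rpow hNR (by positivity)
  have hA0 : 0 < A := by linarith
  have hApow : A ^ (2 * α + 1) = (2 : ℝ) ^ N * R ^ 2 := by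
    rw [hA, ← Real.rpow_mul (by positivity), one_div_mul_cancel (by positivity), Real.rpow_one]
  have hAN : A < 2 ^ N := by
    by_contra! hle
    have h1 : ((2 : ℝ) ^ N) ^ (2 * α + 1) ≤ (2 : ℝ) ^ N * R ^ 2 := by
      rw [← hApow]
      exact Real.rpow_le_rpow (by positivity) hle (by positivity)
    rw [Real.rpow_add_one (by positivity), two_mul, Real.rpow_add (by positivity)] at h1
    have h2 : R ^ 2 < ((2 : ℝ) ^ N) ^ α * ((2 : ℝ) ^ N) ^ α := by
      rw [sq]
      exact mul_lt_mul'' hRN hRN hR.le hR.le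
    have h3 : (0 : ℝ) < 2 ^ N := by positivity
    nlinarith
  obtain ⟨J, hJ1, hJ2⟩ := exists_nat_pow_near hA1 one_lt_two
  have hJN : J < N := by
    have := hJ1.trans_lt hAN
    exact (pow_lt_pow_iff_right₀ one_lt_two).1 this
  obtain ⟨m, hm, hbias⟩ := exists_mem_collectionAt_sum_le (J := J) hR hp hp2 hα hs
  refine ⟨m, ⟨J, hJN, hm⟩, ?_, ?_⟩
  · have hmc := subset_coarse_of_mem_modelsAt hJN (mem_modelsAt hm)
    refine (norm_sub_leastSquares_sq_le hmc s).trans (hbias.trans ?_)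
    rw [← hApow, mul_assoc (besovConst α p), mul_assoc (besovConst α p)]
    refine mul_le_mul_of_nonneg_left ?_ (besovConst_nonneg α p)
    have h1 : A ^ (2 * α) ≤ 2 ^ (2 * α) * 2 ^ (2 * α * J) := by
      rw [← Real.rpow_add two_pos]
      have h2 := Real.rpow_le_rpow hA0.le hJ2.le (show 0 ≤ 2 * α by positivity)
      rw [← Real.rpow_natCast, ← Real.rpow_mul two_pos.le] at h2
      refine h2.trans (le_of_eq ?_)
      congr 1
      push_cast
      ring
    rw [Real.rpow_add_one hA0.ne', Real.rpow_neg two_pos.le, ← div_eq_mul_inv,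
      div_le_iff₀ (by positivity)]
    nlinarith
  · have h1 : (Module.finrank ℝ (model N m) : ℝ) ≤ m.card := by
      exact_mod_cast finrank_model_le_card N m
    linarith [card_le_of_mem_modelsAt (mem_modelsAt hm)]

/-! ### The penalized estimator -/

theorem contrast_eq {r n : ℕ} (x t : Mat r n) : contrast x t = ‖x - t‖ ^ 2 - ‖x‖ ^ 2 := by
  rw [contrast, norm_sub_sq_real]
  ring

theorem norm_sub_sq_eq_contrast {r n : ℕ} (x s t : Mat r n) :
    ‖s - t‖ ^ 2 = ‖s‖ ^ 2 + contrast x t + 2 * inner ℝ (x - s) t := by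
  rw [contrast, norm_sub_sq_real, inner_sub_left]
  ring

theorem contrast_leastSquares_le {r N : ℕ} (m : Finset (ℤ × ℕ)) (x t : Mat r (2 ^ N))
    (ht : t ∈ tensor r (model N m)) : contrast x (leastSquares m x) ≤ contrast x t := by
  rw [contrast_eq, contrast_eq]
  have e : x - leastSquares m x = (tensor r (model N m))ᗮ.starProjection (x - t) := by
    rw [Submodule.starProjection_orthogonal_val, map_sub, Submodule.starProjection_eq_self_iff.2 ht,
      leastSquares]
    abel
  rw [e]
  gcongr
  exact Submodule.norm_starProjection_apply_le _ _

theorem leastSquares_mem_tensor {r N : ℕ} {m m' : Finset (ℤ × ℕ)} (h : m ⊆ m')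
    (x : Mat r (2 ^ N)) : leastSquares m x ∈ tensor r (model N m') := fun j =>
  Submodule.span_mono (Set.image_mono (Finset.coe_subset.2 h))
    ((tensor r (model N m)).starProjection_apply_mem x j)

/-- Deterministic form of the oracle inequality: a model that is preferred to `m` by the criterion does
as well as `m` up to the projection of the noise `x - s` on the sum of the two models. -/
theorem norm_sub_leastSquares_sq_le_of_criterion_le {r N : ℕ} {c : ℝ} {m m' : Finset (ℤ × ℕ)}
    {x : Mat r (2 ^ N)} (s : Mat r (2 ^ N)) (h : criterion c x m' ≤ criterion c x m) :
    ‖s - leastSquares m' x‖ ^ 2 / 2 ≤ 3 / 2 * ‖s - leastSquares m s‖ ^ 2 + penalty c N m -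
      penalty c N m' + 4 * ‖(tensor r (model N (m ∪ m'))).starProjection (x - s)‖ ^ 2 := by
  have h1 := contrast_leastSquares_le m x (leastSquares m s)
    (leastSquares_mem_tensor (Finset.Subset.refl m) s)
  have h2 := norm_sub_sq_eq_contrast x s (leastSquares m' x)
  have h3 := norm_sub_sq_eq_contrast x s (leastSquares m s)
  rw [criterion, criterion] at h
  set v := leastSquares m' x - leastSquares m s with hv
  have hvU : v ∈ tensor r (model N (m ∪ m')) := Submodule.sub_mem _
    (leastSquares_mem_tensor Finset.subset_union_right x)
    (leastSquares_mem_tensor Finset.subset_union_left s)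
  have h4 : inner ℝ (x - s) v = inner ℝ (x - s) (leastSquares m' x) -
      inner ℝ (x - s) (leastSquares m s) := inner_sub_right _ _ _
  have h5 : inner ℝ (x - s) v ≤
      ‖(tensor r (model N (m ∪ m'))).starProjection (x - s)‖ * ‖v‖ := by
    have h6 := Submodule.inner_starProjection_left_eq_right (tensor r (model N (m ∪ m'))) (x - s) v
    rw [Submodule.starProjection_eq_self_iff.2 hvU] at h6
    rw [← h6]
    exact real_inner_le_norm _ _
  have h7 : ‖v‖ ≤ ‖s - leastSquares m s‖ + ‖s - leastSquares m' x‖ := by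
    have : v = (s - leastSquares m s) - (s - leastSquares m' x) := by rw [hv]; abel
    rw [this]
    exact norm_sub_le _ _
  have h8 : ‖v‖ ^ 2 ≤ 2 * ‖s - leastSquares m s‖ ^ 2 + 2 * ‖s - leastSquares m' x‖ ^ 2 := by
    have := pow_le_pow_left₀ (norm_nonneg v) h7 2
    nlinarith [sq_nonneg (‖s - leastSquares m s‖ - ‖s - leastSquares m' x‖)]
  -- `2 a b ≤ 4 a² + b² / 4`, the `b² / 4` being absorbed by the left-hand side through `h8`.
  nlinarith [sq_nonneg (4 * ‖(tensor r (model N (m ∪ m'))).starProjection (x - s)‖ - ‖v‖)]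

/-- The sum, over the models `m'` of the strategy, of the exponential of the normalized squared norm
of the noise `x - s` projected on the model with index set `m ∪ m'`. The normalization
`D_m / 2 + D_m' / 2` has the expectation of each exponential at most `1`, and the further
`9 * D_m'` makes the sum of these expectations bounded. -/
def deviation {r N : ℕ} (m : Finset (ℤ × ℕ)) (s x : Mat r (2 ^ N)) : ℝ :=
  ∑ J ∈ Finset.range N, ∑ m' ∈ modelsAt N J,
    Real.exp (‖(tensor r (model N (m ∪ m'))).starProjection (x - s)‖ ^ 2 / 8 -
      (Module.finrank ℝ (model N m) : ℝ) / 2 - 19 / 2 * (Module.finrank ℝ (model N m') : ℝ))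

theorem norm_starProjection_sq_le_deviation {r N : ℕ} (m : Finset (ℤ × ℕ)) {m' : Finset (ℤ × ℕ)}
    (hm' : m' ∈ collection N) (s x : Mat r (2 ^ N)) :
    ‖(tensor r (model N (m ∪ m'))).starProjection (x - s)‖ ^ 2 ≤
      4 * (Module.finrank ℝ (model N m) : ℝ) + 76 * (Module.finrank ℝ (model N m') : ℝ) +
        8 * deviation m s x := by
  obtain ⟨J, hJ, hm'⟩ := hm'
  have h1 := Finset.single_le_sum (f := fun m' => Real.exp
    (‖(tensor r (model N (m ∪ m'))).starProjection (x - s)‖ ^ 2 / 8 -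
      (Module.finrank ℝ (model N m) : ℝ) / 2 - 19 / 2 * (Module.finrank ℝ (model N m') : ℝ)))
    (fun _ _ => (Real.exp_pos _).le) (mem_modelsAt hm')
  have h2 := Finset.single_le_sum (f := fun J => ∑ m' ∈ modelsAt N J, Real.exp
    (‖(tensor r (model N (m ∪ m'))).starProjection (x - s)‖ ^ 2 / 8 -
      (Module.finrank ℝ (model N m) : ℝ) / 2 - 19 / 2 * (Module.finrank ℝ (model N m') : ℝ)))
    (fun _ _ => Finset.sum_nonneg fun _ _ => (Real.exp_pos _).le) (Finset.mem_range.2 hJ)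
  -- Each exponent is at most its exponential, hence at most the sum of all of them.
  have h3 := (Real.add_one_le_exp _).trans (h1.trans h2)
  rw [deviation]
  linarith

theorem IsMultinomialSample.integral_deviation_le
    {Ω : Type*} [MeasurableSpace Ω] {P : Measure Ω} [IsProbabilityMeasure P] {r N : ℕ}
    {X : Ω → Mat r (2 ^ N)} {s : Mat r (2 ^ N)} (hX : IsMultinomialSample P X s)
    (m : Finset (ℤ × ℕ)) : ∫ ω, deviation m s (X ω) ∂P ≤ 2 := by
  refine le_trans ?_ (sum_models_exp_le N)
  simp only [deviation]
  rw [integral_finsetSum _ fun J _ => integrable_finsetSum _ fun m' _ =>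
    hX.integrable_comp fun x => Real.exp
    (‖(tensor r (model N (m ∪ m'))).starProjection (x - s)‖ ^ 2 / 8 -
      (Module.finrank ℝ (model N m) : ℝ) / 2 - 19 / 2 * (Module.finrank ℝ (model N m') : ℝ))]
  refine Finset.sum_le_sum fun J _ => ?_
  rw [integral_finsetSum _ fun m' _ => hX.integrable_comp fun x => Real.exp
    (‖(tensor r (model N (m ∪ m'))).starProjection (x - s)‖ ^ 2 / 8 -
      (Module.finrank ℝ (model N m) : ℝ) / 2 - 19 / 2 * (Module.finrank ℝ (model N m') : ℝ))]
  refine Finset.sum_le_sum fun m' _ => ?_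
  simp_rw [sub_sub, Real.exp_sub]
  rw [integral_div, div_le_iff₀ (Real.exp_pos _), ← Real.exp_add]
  refine (hX.integral_exp_norm_starProjection_sq_le _).trans (Real.exp_le_exp.2 ?_)
  have h : (Module.finrank ℝ (model N (m ∪ m')) : ℝ) ≤
      Module.finrank ℝ (model N m) + Module.finrank ℝ (model N m') := by
    exact_mod_cast finrank_model_union_le N m m'
  linarith

/-- Oracle inequality. The threshold `304` is `4 * 76`, the factor of `D_m'` left after bounding
the noise by `norm_starProjection_sq_le_deviation`. -/
theorem IsMultinomialSample.integral_norm_sub_sq_le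
    {Ω : Type*} [MeasurableSpace Ω] {P : Measure Ω} [IsProbabilityMeasure P] {r N : ℕ}
    {X : Ω → Mat r (2 ^ N)} {s : Mat r (2 ^ N)} (hX : IsMultinomialSample P X s)
    {c : ℝ} (hc : 304 ≤ c) {est : Mat r (2 ^ N) → Mat r (2 ^ N)} (hest : IsNEHEstimator c est)
    {m : Finset (ℤ × ℕ)} (hm : m ∈ collection N) :
    ∫ ω, ‖s - est (X ω)‖ ^ 2 ∂P ≤ 3 * ‖s - leastSquares m s‖ ^ 2 +
      2 * (c + 16) * (Module.finrank ℝ (model N m) : ℝ) + 128 := by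
  have hpt : ∀ x, ‖s - est x‖ ^ 2 ≤ 3 * ‖s - leastSquares m s‖ ^ 2 +
      2 * (c + 16) * (Module.finrank ℝ (model N m) : ℝ) + 64 * deviation m s x := fun x => by
    obtain ⟨m', hm', hmin, he⟩ := hest x
    have h1 := norm_sub_leastSquares_sq_le_of_criterion_le s (hmin m hm)
    have h2 := norm_starProjection_sq_le_deviation m hm' s x
    rw [penalty, penalty] at h1
    rw [he]
    have h3 : 304 * (Module.finrank ℝ (model N m') : ℝ) ≤
      c * (Module.finrank ℝ (model N m') : ℝ) := by gcongr
    linarith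
  have hdev := hX.integrable_comp fun x => 64 * deviation m s x
  calc ∫ ω, ‖s - est (X ω)‖ ^ 2 ∂P
      ≤ ∫ ω, (3 * ‖s - leastSquares m s‖ ^ 2 +
          2 * (c + 16) * (Module.finrank ℝ (model N m) : ℝ) + 64 * deviation m s (X ω)) ∂P :=
        integral_mono (hX.integrable_comp fun x => ‖s - est x‖ ^ 2)
          ((integrable_const _).add hdev) fun ω => hpt (X ω)
    _ = 3 * ‖s - leastSquares m s‖ ^ 2 + 2 * (c + 16) * (Module.finrank ℝ (model N m) : ℝ) +
          64 * ∫ ω, deviation m s (X ω) ∂P := by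
        rw [integral_add (integrable_const _) hdev, integral_const_mul]
        simp
    _ ≤ _ := by linarith [hX.integral_deviation_le m]

end NEH

end

theorem theorem5 :
    ∃ c₀ : ℝ, 0 < c₀ ∧ ∀ c : ℝ, c₀ ≤ c →
      ∀ p α : ℝ, 0 < p → p ≤ 2 → 1 / p - 1 / 2 < α →
        ∃ C : ℝ, 0 < C ∧
          ∀ (N r : ℕ) (R : ℝ), 1 ≤ N → 2 ≤ r → 0 < R →
            R < ((2 : ℝ) ^ N) ^ α → 1 ≤ (2 : ℝ) ^ N * R ^ 2 →
            ∀ est : NEH.Mat r (2 ^ N) → NEH.Mat r (2 ^ N), NEH.IsNEHEstimator c est →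
            ∀ s ∈ NEH.besovClass r N R α p,
            ∀ (Ω : Type*) [MeasurableSpace Ω] (P : Measure Ω) [IsProbabilityMeasure P]
              (X : Ω → NEH.Mat r (2 ^ N)), NEH.IsMultinomialSample P X s →
              Integrable (fun ω => ‖s - est (X ω)‖ ^ 2) P ∧
                ∫ ω, ‖s - est (X ω)‖ ^ 2 ∂P ≤
                  C * ((2 : ℝ) ^ N * R ^ 2) ^ (1 / (2 * α + 1)) := by
  refine ⟨304, by norm_num, fun c hc p α hp hp2 hα => ?_⟩
  have hK := NEH.besovConst_nonneg α p
  refine ⟨3 * (NEH.besovConst α p * 2 ^ (2 * α)) + 6 * (c + 16) + 128, by positivity, ?_⟩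
  intro N r R _ _ hR hRN hNR est hest s hs Ω _ P _ X hX
  refine ⟨hX.integrable_comp fun x => ‖s - est x‖ ^ 2, ?_⟩
  obtain ⟨m, hm, hbias, hdim⟩ := NEH.exists_mem_collection_bias_le hR hp hp2 hα hRN hNR hs.1
  refine (hX.integral_norm_sub_sq_le hc hest hm).trans ?_
  have hα0 : 0 < α := by
    have : 1 / 2 ≤ 1 / p := one_div_le_one_div_of_le hp hp2
    linarith
  have hA : 1 ≤ ((2 : ℝ) ^ N * R ^ 2) ^ (1 / (2 * α + 1)) :=
    Real.one_le_rpow hNR (by positivity)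
  have hdim' := mul_le_mul_of_nonneg_left hdim (show 0 ≤ 2 * (c + 16) by linarith)
  linarith
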